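/- Let $\mathbb N^\times$ be the multiplicative monoid of positive integers, viewed as a category with one object $*$, and let $\widehat{\mathbb N^\times}$ be the topos of presheaves of sets on it. Let $\mathcal O=\mathbb Z_{\max}=(\mathbb Z\cup\{-\infty\},\max,+)$ be the semiring in this topos on which $k\in\mathbb N^\times$ acts by $n\mapsto kn$ (and $-\infty\mapsto-\infty$). Let $\mathbb R_+^{\max}$ be the semifield $[0,\infty)$ with addition $\max$ and the usual product, with its automorphisms $\mathrm{Fr}_\lambda(x)=x^\lambda$, $\lambda>0$. A point of the arithmetic site $(\widehat{\mathbb N^\times},\mathcal O)$ over $\mathbb R_+^{\max}$ is a pair $(p,f)$, where $p$ is a point of the topos (a geometric morphism from the topos of sets) and $f:\mathcal O_p=p^*\mathcal O\to\mathbb R_+^{\max}$ is a morphism of semirings; $(p,f)$ and $(q,g)$ are equivalent if there is an isomorphism $\phi:p\simeq q$ with $g\circ\phi^\#=f$, where $\phi^\#:\mathcal O_p\to\mathcal O_q$ is the induced isomorphism of stalks. $\mathrm{Fr}_\lambda$ acts on classes of points by $(p,f)\mapsto(p,\mathrm{Fr}_\lambda\circ f)$. Let $\mathbb A_{\mathbb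 Q}=\mathbb R\times\mathbb A^f$ be the adeles of $\mathbb Q$, $\hat{\mathbb Z}=\prod_p\mathbb Z_p\subset\mathbb A^f$, and for $a\in\mathbb A^f$ let $H_a=\{q\in\mathbb Q\mid aq\in\hat{\mathbb Z}\}$. The group $\hat{\mathbb Z}^\times$ acts on $\mathbb A_{\mathbb Q}$ through the finite component and $\mathbb Q^\times$ acts diagonally. Theorem. There is a bijection $\Theta$ from the set of equivalence classes of points of $(\widehat{\mathbb N^\times},\mathcal O)$ over $\mathbb R_+^{\max}$ onto $\hat{\mathbb Z}^\times\backslash\mathbb A_{\mathbb Q}/\mathbb Q^\times$ such that: (1) $\Theta$ is the canonical one: with $y$ the representable presheaf, $X=p^*(y)$ with its action of $\mathbb N^\times$, and $\beta:X\to\mathcal O_p$ the map induced by the section $1\in\mathbb Z$, one has $\Theta(p,f)=[(r,a)]$ if and only if there is an $\mathbb N^\times$-equivariant bijection $j:X\to\{h\in H_a\mid h>0\}$ with $f(\beta(x))=e^{|r|j(x)}$ for all $x\in X$. (2) $\Theta(p,\mathrm{Fr}_\lambda\circ f)=\lambda\cdot\Theta(p,f)$ for all $\lambda>0$, where $\lambda$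 acts through the class of the idele $(\lambda,1)$ in the idele class group $\mathbb A_{\mathbb Q}^\times/\mathbb Q^\times$. Conversely every idele class is the class of $(\lambda,u)$ for some $u\in\hat{\mathbb Z}^\times$ and $\lambda>0$, and acts as $\mathrm{Fr}_\lambda$. (3) $(p,f)$ is degenerate, i.e. $f$ has range in $\{0,1\}$, if and only if $\Theta(p,f)$ is the class of some $(0,a)$ with $a\in\mathbb A^f$, and if and only if its class is fixed by all $\mathrm{Fr}_\lambda$. (4) If $\Theta(p,f)=[(r,a)]$ then $\{\log u\mid u\in f(\mathcal O_p),\ u\neq0\}=|r|H_a\subset\mathbb R$. -/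

import Mathlib

open CategoryTheory Opposite
open scoped NNReal

noncomputable section

namespace ArithSite

/-! ### The semifields of characteristic one -/

/-- The tropical integers: `ℤ ∪ {-∞}` with addition `max` and multiplication `+`. -/
def ZMax : Type := WithBot ℤ

namespace ZMax

/-- The element of `ZMax` given by an element of `ℤ ∪ {-∞}`. -/
def mk (x : WithBot ℤ) : ZMax := x

/-- The underlying element of `ℤ ∪ {-∞}`. -/
def val (x : ZMax) : WithBot ℤ := x

instance : Add ZMax := ⟨fun x y => mk (max x.val y.val)⟩

instance : Mul ZMax := ⟨fun x y => mk (x.val + y.val)⟩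

instance : Zero ZMax := ⟨mk ⊥⟩

instance : One ZMax := ⟨mk 0⟩

instance : CommSemiring ZMax where
  nsmul := nsmulRec
  add_assoc x y z := max_assoc x.val y.val z.val
  zero_add x := max_eq_right (bot_le (a := x.val))
  add_zero x := max_eq_left (bot_le (a := x.val))
  add_comm x y := max_comm x.val y.val
  mul_assoc x y z := add_assoc x.val y.val z.val
  one_mul x := zero_add x.val
  mul_one x := add_zero x.val
  mul_comm x y := add_comm x.val y.val
  zero_mul x := WithBot.bot_add x.val
  mul_zero x := WithBot.add_bot x.val
  left_distrib x y z := (max_add_add_left x.val y.val z.val).symm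
  right_distrib x y z := (max_add_add_right x.val y.val z.val).symm

/-- The Frobenius endomorphism `Fr_k : n ↦ k n`, `-∞ ↦ -∞`. -/
def frob (k : ℕ+) : ZMax →+* ZMax where
  toFun x := mk (x.val.map fun n : ℤ => (k : ℤ) * n)
  map_one' := congrArg (fun n : ℤ => mk (n : WithBot ℤ)) (mul_zero (k : ℤ))
  map_zero' := rfl
  map_mul' x y := by
    change WithBot.map (fun n : ℤ => (k : ℤ) * n) (x.val + y.val) =
      WithBot.map (fun n : ℤ => (k : ℤ) * n) x.val + WithBot.map (fun n : ℤ => (k : ℤ) * n) y.val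
    induction x.val using WithBot.recBotCoe with
    | bot => simp
    | coe a =>
      induction y.val using WithBot.recBotCoe with
      | bot => simp
      | coe b => exact congrArg _ (mul_add (k : ℤ) a b)
  map_add' x y := by
    have h : Monotone fun n : ℤ => (k : ℤ) * n := fun a b hab =>
      mul_le_mul_of_nonneg_left hab (by positivity)
    exact (h.withBot_map).map_max

theorem frob_mul (k l : ℕ+) (x : ZMax) : frob (k * l) x = frob l (frob k x) := by
  change WithBot.map (fun n : ℤ => ((k * l : ℕ+) : ℤ) * n) x.val =
    WithBot.map (fun n : ℤ => (l : ℤ) * n) (WithBot.map (fun n : ℤ => (k : ℤ) * n) x.val)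
  rw [WithBot.map_map]
  congr 1
  funext n
  simp only [PNat.mul_coe, Nat.cast_mul, Function.comp]
  ring

end ZMax

/-- The multiplicative tropical semifield: `[0,∞)` with addition `max` and the usual product. -/
def RMax : Type := ℝ≥0

namespace RMax

/-- The element of `RMax` given by a nonnegative real number. -/
def mk (x : ℝ≥0) : RMax := x

/-- The underlying nonnegative real number. -/
def val (x : RMax) : ℝ≥0 := x

instance : Add RMax := ⟨fun x y => mk (max x.val y.val)⟩

instance : Mul RMax := ⟨fun x y => mk (x.val * y.val)⟩

instance : Zero RMax := ⟨mk 0⟩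

instance : One RMax := ⟨mk 1⟩

instance : CommSemiring RMax where
  nsmul := nsmulRec
  add_assoc x y z := max_assoc x.val y.val z.val
  zero_add x := max_eq_right (zero_le : 0 ≤ x.val)
  add_zero x := max_eq_left (zero_le : 0 ≤ x.val)
  add_comm x y := max_comm x.val y.val
  mul_assoc x y z := mul_assoc x.val y.val z.val
  one_mul x := one_mul x.val
  mul_one x := mul_one x.val
  mul_comm x y := mul_comm x.val y.val
  zero_mul x := zero_mul x.val
  mul_zero x := mul_zero x.val
  left_distrib x y z := mul_max_of_nonneg y.val z.val (zero_le : 0 ≤ x.val)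
  right_distrib x y z := max_mul_of_nonneg x.val y.val (zero_le : 0 ≤ z.val)

/-- The Frobenius automorphism `Fr_t : x ↦ x ^ t` of `RMax`, for `t > 0`. -/
def frob (t : {t : ℝ // 0 < t}) : RMax ≃+* RMax where
  toFun x := mk (x.val ^ (t : ℝ))
  invFun x := mk (x.val ^ (t : ℝ)⁻¹)
  left_inv x := NNReal.rpow_rpow_inv t.2.ne' x.val
  right_inv x := NNReal.rpow_inv_rpow t.2.ne' x.val
  map_mul' _ _ := NNReal.mul_rpow
  map_add' _ _ := (NNReal.monotone_rpow_of_nonneg t.2.le).map_max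

end RMax

/-! ### Geometric morphisms, points and stalks -/

universe u

/-- A geometric morphism `E → F`: an adjoint pair `f^* ⊣ f_*` with `f^*` left exact. -/
structure GeomMorphism (E : Type*) [Category* E] (F : Type*) [Category* F] where
  /-- the inverse image functor `f^*` -/
  inverseImage : F ⥤ E
  /-- the direct image functor `f_*` -/
  directImage : E ⥤ F
  /-- the adjunction `f^* ⊣ f_*` -/
  adj : inverseImage ⊣ directImage
  leftExact : Limits.PreservesFiniteLimits inverseImage

attribute [instance] GeomMorphism.leftExact

/-- A point of the presheaf topos on a small category `C`: a geometric morphism from the topos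
of sets to the topos of presheaves of sets on `C`. -/
abbrev ToposPoint (C : Type u) [SmallCategory C] := GeomMorphism (Type u) (Cᵒᵖ ⥤ Type u)

namespace ToposPoint

open FunctorToTypes

variable {C : Type u} [SmallCategory C] (p : ToposPoint C)

/-- The comparison map `p^*(F × G) → p^* F × p^* G`. -/
def prodComparison (F G : Cᵒᵖ ⥤ Type u) (t : p.inverseImage.obj (FunctorToTypes.prod F G)) :
    p.inverseImage.obj F × p.inverseImage.obj G :=
  (p.inverseImage.map prod.fst t, p.inverseImage.map prod.snd t)

theorem prodComparison_bijective (F G : Cᵒᵖ ⥤ Type u) :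
    Function.Bijective (p.prodComparison F G) := by
  have hl := Limits.mapIsLimitOfPreservesOfIsLimit p.inverseImage _ _
    (FunctorToTypes.binaryProductLimit F G)
  let e := hl.conePointUniqueUpToIso (Limits.Types.binaryProductLimit _ _)
  have he : ∀ t, e.hom t = p.prodComparison F G t := fun t => by
    have h1 := ConcreteCategory.congr_hom
      (hl.conePointUniqueUpToIso_hom_comp (Limits.Types.binaryProductLimit _ _)
        ⟨Limits.WalkingPair.left⟩) t
    have h2 := ConcreteCategory.congr_hom
      (hl.conePointUniqueUpToIso_hom_comp (Limits.Types.binaryProductLimit _ _)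
        ⟨Limits.WalkingPair.right⟩) t
    exact Prod.ext h1 h2
  have : Function.Bijective e.hom := (isIso_iff_bijective e.hom).1 inferInstance
  rwa [show (e.hom : _ → _) = p.prodComparison F G from funext he] at this

/-- The canonical bijection `p^* F × p^* G ≃ p^*(F × G)`. -/
def prodEquiv (F G : Cᵒᵖ ⥤ Type u) :
    p.inverseImage.obj F × p.inverseImage.obj G ≃
      p.inverseImage.obj (FunctorToTypes.prod F G) :=
  (Equiv.ofBijective _ (p.prodComparison_bijective F G)).symm

/-- The terminal presheaf. -/
def terminalPresheaf (C : Type u) [SmallCategory C] : Cᵒᵖ ⥤ Type u :=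
  (Functor.const _).obj PUnit

/-- The unique map to the terminal presheaf. -/
def toTerminal (F : Cᵒᵖ ⥤ Type u) : F ⟶ terminalPresheaf C where
  app _ := ↾fun _ => PUnit.unit

/-- The terminal presheaf is terminal. -/
def terminalPresheafIsTerminal : Limits.IsTerminal (terminalPresheaf C) :=
  Limits.IsTerminal.ofUniqueHom toTerminal fun _ _ => rfl

/-- The inverse image of the terminal presheaf is a one-point set. -/
instance uniqueTerminal : Unique (p.inverseImage.obj (terminalPresheaf C)) :=
  Limits.Types.isTerminalEquivUnique _
    (Limits.IsTerminal.isTerminalObj p.inverseImage _ terminalPresheafIsTerminal)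

/-- The binary operation on `p^* F` induced by a binary operation `F × F → F`. -/
def stalkOp {F : Cᵒᵖ ⥤ Type u} (m : FunctorToTypes.prod F F ⟶ F) (a b : p.inverseImage.obj F) :
    p.inverseImage.obj F :=
  p.inverseImage.map m (p.prodEquiv F F (a, b))

/-- The element of `p^* F` induced by a global section `1 → F`. -/
def stalkConst {F : Cᵒᵖ ⥤ Type u} (z : terminalPresheaf C ⟶ F) : p.inverseImage.obj F :=
  p.inverseImage.map z default

theorem stalkOp_map {F G : Cᵒᵖ ⥤ Type u} (m : FunctorToTypes.prod F F ⟶ F) (a b : G ⟶ F)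
    (t : p.inverseImage.obj G) :
    p.stalkOp m (p.inverseImage.map a t) (p.inverseImage.map b t) =
      p.inverseImage.map (prod.lift a b ≫ m) t := by
  have h : p.prodEquiv F F (p.inverseImage.map a t, p.inverseImage.map b t) =
      p.inverseImage.map (prod.lift a b) t := by
    apply (p.prodComparison_bijective F F).1
    refine ((Equiv.ofBijective _ (p.prodComparison_bijective F F)).apply_symm_apply _).trans ?_
    refine Prod.ext ?_ ?_
    · exact ConcreteCategory.congr_hom (p.inverseImage.map_comp (prod.lift a b) prod.fst) t
    · exact ConcreteCategory.congr_hom (p.inverseImage.map_comp (prod.lift a b) prod.snd) t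
  rw [stalkOp, h]
  exact (ConcreteCategory.congr_hom (p.inverseImage.map_comp (prod.lift a b) m) t).symm

theorem stalkConst_map {F G : Cᵒᵖ ⥤ Type u} (z : terminalPresheaf C ⟶ F)
    (t : p.inverseImage.obj G) :
    p.stalkConst z = p.inverseImage.map (toTerminal G ≫ z) t := by
  refine Eq.trans ?_ (ConcreteCategory.congr_hom (p.inverseImage.map_comp (toTerminal G) z) t).symm
  exact congrArg (p.inverseImage.map z)
    (Subsingleton.elim (α := p.inverseImage.obj (terminalPresheaf C)) _ _)

theorem exists_two {F : Cᵒᵖ ⥤ Type u} (a b : p.inverseImage.obj F) :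
    ∃ t : p.inverseImage.obj (FunctorToTypes.prod F F),
      p.inverseImage.map prod.fst t = a ∧ p.inverseImage.map prod.snd t = b := by
  obtain ⟨t, ht⟩ := (p.prodComparison_bijective F F).2 (a, b)
  exact ⟨t, congrArg Prod.fst ht, congrArg Prod.snd ht⟩

theorem exists_three {F : Cᵒᵖ ⥤ Type u} (a b c : p.inverseImage.obj F) :
    ∃ t : p.inverseImage.obj (FunctorToTypes.prod F (FunctorToTypes.prod F F)),
      p.inverseImage.map prod.fst t = a ∧ p.inverseImage.map (prod.snd ≫ prod.fst) t = b ∧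
        p.inverseImage.map (prod.snd ≫ prod.snd) t = c := by
  obtain ⟨s, rfl, rfl⟩ := p.exists_two b c
  obtain ⟨t, ht⟩ := (p.prodComparison_bijective F (FunctorToTypes.prod F F)).2 (a, s)
  refine ⟨t, congrArg Prod.fst ht, ?_, ?_⟩ <;>
    rw [Functor.map_comp, ← show p.inverseImage.map prod.snd t = s from congrArg Prod.snd ht] <;>
    rfl

end ToposPoint

section Stalk

variable {C : Type u} [SmallCategory C]

/-- The underlying presheaf of sets of a presheaf of semirings. -/
abbrev underlying (O : Cᵒᵖ ⥤ CommSemiRingCat.{u}) : Cᵒᵖ ⥤ Type u :=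
  O ⋙ forget CommSemiRingCat

variable (O : Cᵒᵖ ⥤ CommSemiRingCat.{u})

/-- The addition `O × O → O`. -/
def addMap : FunctorToTypes.prod (underlying O) (underlying O) ⟶ underlying O where
  app U := ↾fun a => ((a.1 : O.obj U) + (a.2 : O.obj U) : O.obj U)
  naturality _ _ f := by
    ext a
    exact (map_add (O.map f).hom _ _).symm

/-- The multiplication `O × O → O`. -/
def mulMap : FunctorToTypes.prod (underlying O) (underlying O) ⟶ underlying O where
  app U := ↾fun a => ((a.1 : O.obj U) * (a.2 : O.obj U) : O.obj U)
  naturality _ _ f := by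
    ext a
    exact (map_mul (O.map f).hom _ _).symm

/-- The zero section `1 → O`. -/
def zeroMap : ToposPoint.terminalPresheaf C ⟶ underlying O where
  app U := ↾fun _ => (0 : O.obj U)
  naturality _ _ f := by
    ext a
    exact (map_zero (O.map f).hom).symm

/-- The unit section `1 → O`. -/
def oneMap : ToposPoint.terminalPresheaf C ⟶ underlying O where
  app U := ↾fun _ => (1 : O.obj U)
  naturality _ _ f := by
    ext a
    exact (map_one (O.map f).hom).symm

/-- The stalk `O_p = p^* O`, a semiring because `p^*` commutes with finite products. -/
def Stalk (O : Cᵒᵖ ⥤ CommSemiRingCat.{u}) (p : ToposPoint C) : Type u :=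
  p.inverseImage.obj (underlying O)

namespace Stalk

variable {O} {p : ToposPoint C}

instance : Add (Stalk O p) := ⟨p.stalkOp (addMap O)⟩

instance : Mul (Stalk O p) := ⟨p.stalkOp (mulMap O)⟩

instance : Zero (Stalk O p) := ⟨p.stalkConst (zeroMap O)⟩

instance : One (Stalk O p) := ⟨p.stalkConst (oneMap O)⟩

open ToposPoint

/-- The value at `t ∈ p^* G` of the map `p^* G → O_p` induced by `a : G → O`. -/
def germ {G : Cᵒᵖ ⥤ Type u} (a : G ⟶ underlying O) (t : p.inverseImage.obj G) : Stalk O p :=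
  p.inverseImage.map a t

theorem germ_add {G : Cᵒᵖ ⥤ Type u} (a b : G ⟶ underlying O) (t : p.inverseImage.obj G) :
    germ a t + germ b t = germ (FunctorToTypes.prod.lift a b ≫ addMap O) t :=
  p.stalkOp_map _ a b t

theorem germ_mul {G : Cᵒᵖ ⥤ Type u} (a b : G ⟶ underlying O) (t : p.inverseImage.obj G) :
    germ a t * germ b t = germ (FunctorToTypes.prod.lift a b ≫ mulMap O) t :=
  p.stalkOp_map _ a b t

theorem zero_eq {G : Cᵒᵖ ⥤ Type u} (t : p.inverseImage.obj G) :
    (0 : Stalk O p) = germ (toTerminal G ≫ zeroMap O) t := p.stalkConst_map _ t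

theorem one_eq {G : Cᵒᵖ ⥤ Type u} (t : p.inverseImage.obj G) :
    (1 : Stalk O p) = germ (toTerminal G ≫ oneMap O) t := p.stalkConst_map _ t

theorem exists_one (a : Stalk O p) :
    ∃ t : p.inverseImage.obj (underlying O), germ (𝟙 (underlying O)) t = a :=
  ⟨a, ConcreteCategory.congr_hom (p.inverseImage.map_id (underlying O)) a⟩

theorem exists_two (a b : Stalk O p) :
    ∃ t : p.inverseImage.obj (FunctorToTypes.prod (underlying O) (underlying O)),
      germ FunctorToTypes.prod.fst t = a ∧ germ FunctorToTypes.prod.snd t = b :=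
  ToposPoint.exists_two p a b

theorem exists_three (a b c : Stalk O p) :
    ∃ t : p.inverseImage.obj (FunctorToTypes.prod (underlying O)
        (FunctorToTypes.prod (underlying O) (underlying O))),
      germ FunctorToTypes.prod.fst t = a ∧
      germ (FunctorToTypes.prod.snd ≫ FunctorToTypes.prod.fst) t = b ∧
      germ (FunctorToTypes.prod.snd ≫ FunctorToTypes.prod.snd) t = c :=
  ToposPoint.exists_three p a b c

theorem germ_congr {G : Cᵒᵖ ⥤ Type u} {a b : G ⟶ underlying O} (t : p.inverseImage.obj G)
    (h : ∀ (U : Cᵒᵖ) (x : G.obj U), a.app U x = b.app U x) : germ a t = germ b t := by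
  have : a = b := by
    ext U x
    exact h U x
  rw [this]

instance : CommSemiring (Stalk O p) where
  nsmul := nsmulRec
  add_assoc a b c := by
    obtain ⟨t, rfl, rfl, rfl⟩ := exists_three a b c
    simp only [germ_add]
    exact germ_congr t fun U _ => add_assoc (G := O.obj U) _ _ _
  zero_add a := by
    obtain ⟨t, rfl⟩ := exists_one a
    rw [zero_eq t]
    simp only [germ_add]
    exact germ_congr t fun U _ => zero_add (M := O.obj U) _
  add_zero a := by
    obtain ⟨t, rfl⟩ := exists_one a
    rw [zero_eq t]
    simp only [germ_add]
    exact germ_congr t fun U _ => add_zero (M := O.obj U) _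
  add_comm a b := by
    obtain ⟨t, rfl, rfl⟩ := exists_two a b
    simp only [germ_add]
    exact germ_congr t fun U _ => add_comm (G := O.obj U) _ _
  mul_assoc a b c := by
    obtain ⟨t, rfl, rfl, rfl⟩ := exists_three a b c
    simp only [germ_mul]
    exact germ_congr t fun U _ => mul_assoc (G := O.obj U) _ _ _
  one_mul a := by
    obtain ⟨t, rfl⟩ := exists_one a
    rw [one_eq t]
    simp only [germ_mul]
    exact germ_congr t fun U _ => one_mul (M := O.obj U) _
  mul_one a := by
    obtain ⟨t, rfl⟩ := exists_one a
    rw [one_eq t]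
    simp only [germ_mul]
    exact germ_congr t fun U _ => mul_one (M := O.obj U) _
  mul_comm a b := by
    obtain ⟨t, rfl, rfl⟩ := exists_two a b
    simp only [germ_mul]
    exact germ_congr t fun U _ => mul_comm (G := O.obj U) _ _
  zero_mul a := by
    obtain ⟨t, rfl⟩ := exists_one a
    rw [zero_eq t]
    simp only [germ_mul]
    exact germ_congr t fun U _ => zero_mul (M₀ := O.obj U) _
  mul_zero a := by
    obtain ⟨t, rfl⟩ := exists_one a
    rw [zero_eq t]
    simp only [germ_mul]
    exact germ_congr t fun U _ => mul_zero (M₀ := O.obj U) _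
  left_distrib a b c := by
    obtain ⟨t, rfl, rfl, rfl⟩ := exists_three a b c
    simp only [germ_mul, germ_add]
    exact germ_congr t fun U _ => mul_add (R := O.obj U) _ _ _
  right_distrib a b c := by
    obtain ⟨t, rfl, rfl, rfl⟩ := exists_three a b c
    simp only [germ_mul, germ_add]
    exact germ_congr t fun U _ => add_mul (R := O.obj U) _ _ _

end Stalk

end Stalk

/-! ### Points over the tropical semifield -/

section RMaxPoints

variable {C : Type u} [SmallCategory C]

/-- A point over `RMax` of the presheaf topos on `C` with structure sheaf `O`: a point `p` of the
topos together with a morphism of semirings from the stalk `O_p` to `RMax`. -/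
structure RMaxPoint (O : Cᵒᵖ ⥤ CommSemiRingCat.{u}) where
  /-- the point of the topos -/
  point : ToposPoint C
  /-- the morphism of semirings on the stalk -/
  hom : Stalk O point →+* RMax

variable (O : Cᵒᵖ ⥤ CommSemiRingCat.{u})

/-- Two points over `RMax` are equivalent when there is an isomorphism of the underlying points
of the topos which is compatible with the morphisms from the stalks to `RMax`. -/
instance RMaxPoint.setoid : Setoid (RMaxPoint O) where
  r P Q := ∃ φ : P.point.inverseImage ≅ Q.point.inverseImage,
    ∀ s : P.point.inverseImage.obj (underlying O), Q.hom (φ.hom.app (underlying O) s) = P.hom s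
  iseqv :=
    { refl := fun P => ⟨Iso.refl _, fun _ => rfl⟩
      symm := by
        rintro P Q ⟨φ, h⟩
        refine ⟨φ.symm, fun s => (h _).symm.trans (congrArg Q.hom ?_)⟩
        exact ConcreteCategory.congr_hom (φ.inv_hom_id_app (underlying O)) s
      trans := by
        rintro P Q R ⟨φ, h⟩ ⟨ψ, k⟩
        exact ⟨φ ≪≫ ψ, fun s => (k _).trans (h s)⟩ }

/-- The set of points over `RMax`, up to equivalence. -/
abbrev RMaxPoints := Quotient (RMaxPoint.setoid O)

variable {O}

/-- The Frobenius `Fr_t` acts on points by composition: `(p, f) ↦ (p, Fr_t ∘ f)`. -/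
def RMaxPoint.frob (t : {t : ℝ // 0 < t}) (P : RMaxPoint O) : RMaxPoint O where
  point := P.point
  hom := (RMax.frob t : RMax →+* RMax).comp P.hom

/-- The action of the Frobenius `Fr_t` on equivalence classes of points. -/
def RMaxPoints.frob (t : {t : ℝ // 0 < t}) : RMaxPoints O → RMaxPoints O :=
  Quotient.map (RMaxPoint.frob t) fun _ _ ⟨φ, h⟩ => ⟨φ, fun s => congrArg (RMax.frob t) (h s)⟩

/-- A point is degenerate when the range of the map on the stalk is contained in `{0, 1}`. -/
def RMaxPoint.IsDegenerate (P : RMaxPoint O) : Prop :=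
  ∀ s, P.hom s = 0 ∨ P.hom s = 1

/-- The set `{log u | u ∈ f(O_p), u ≠ 0}` attached to a point `(p, f)`. -/
def RMaxPoint.logRange (P : RMaxPoint O) : Set ℝ :=
  {y | ∃ s, P.hom s ≠ 0 ∧ y = Real.log ((P.hom s).val : ℝ)}

end RMaxPoints

/-! ### The arithmetic site -/

/-- The structure sheaf of the arithmetic site: the semiring `ZMax` in the topos of presheaves on
the one-object category `ℕ+`, where `k` acts by the Frobenius endomorphism `Fr_k`. -/
def structureSheaf : (SingleObj ℕ+)ᵒᵖ ⥤ CommSemiRingCat.{0} where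
  obj _ := CommSemiRingCat.of ZMax
  map f := CommSemiRingCat.ofHom (ZMax.frob f.unop)
  map_id _ := by
    ext x
    change WithBot.map (fun n : ℤ => (((1 : ℕ+) : ℕ) : ℤ) * n) (ZMax.val x) = ZMax.val x
    cases ZMax.val x <;> simp
  map_comp f g := by
    ext x
    exact ZMax.frob_mul f.unop g.unop x

/-- The representable object of the topos. -/
abbrev rep : (SingleObj ℕ+)ᵒᵖ ⥤ Type := yoneda.obj (SingleObj.star ℕ+)

/-- The set `X = F(∗)` of the flat functor `F : ℕ+ → Sets` of the point `p`. -/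
abbrev flatSet (p : ToposPoint (SingleObj ℕ+)) : Type := p.inverseImage.obj rep

/-- The action `F(k) : X → X`. -/
def flatAct (p : ToposPoint (SingleObj ℕ+)) (k : ℕ+) (x : flatSet p) : flatSet p :=
  p.inverseImage.map (yoneda.map (SingleObj.toEnd ℕ+ k)) x

/-- The map `rep → ZMax` given by the section `1 ∈ ℤ`, by Yoneda. -/
def unitSection : rep ⟶ underlying structureSheaf :=
  yonedaEquiv.symm (ZMax.mk ((1 : ℤ) : WithBot ℤ) : ZMax)

/-- The canonical map from `X` to the stalk of the structure sheaf. (When the point is the one of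
the rank one ordered group `H`, it is the inclusion `H_{>0} ⊂ H ∪ {-∞}`.) -/
def toStalk (p : ToposPoint (SingleObj ℕ+)) (x : flatSet p) : Stalk structureSheaf p :=
  Stalk.germ unitSection x

/-! ### Adeles of `ℚ` -/

/-- The ring of adeles of `ℚ`. -/
abbrev Adele := NumberField.AdeleRing ℤ ℚ

/-- The ring of finite adeles of `ℚ`. -/
abbrev FinAdele := IsDedekindDomain.FiniteAdeleRing ℤ ℚ

/-- Every infinite place of `ℚ` is real. -/
theorem isReal_place (v : NumberField.InfinitePlace ℚ) : v.IsReal :=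
  NumberField.IsTotallyReal.isReal v

/-- The real numbers as the Archimedean part of the adeles. -/
def realEquiv : NumberField.InfiniteAdeleRing ℚ ≃+* ℝ :=
  (RingEquiv.piUnique fun v : NumberField.InfinitePlace ℚ => v.Completion).trans
    (NumberField.InfinitePlace.Completion.ringEquivRealOfIsReal (isReal_place default))

namespace Adele

/-- The Archimedean component of an adele, as a real number. -/
def real (α : Adele) : ℝ := realEquiv α.1

/-- The finite component of an adele. -/
def fin (α : Adele) : FinAdele := α.2

/-- The adele with given Archimedean and finite components. -/
def mk (r : ℝ) (a : FinAdele) : Adele := (realEquiv.symm r, a)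

/-- `mk` is multiplicative. -/
def mkHom : ℝ × FinAdele →* Adele where
  toFun x := mk x.1 x.2
  map_one' := Prod.ext (map_one realEquiv.symm) rfl
  map_mul' x y := Prod.ext (map_mul realEquiv.symm x.1 y.1) rfl

end Adele

/-- The subring `Ẑ = ∏ ℤ_p` of the ring of finite adeles. -/
def zHat : Subring FinAdele where
  carrier := {a | ∀ v, a v ∈ v.adicCompletionIntegers ℚ}
  mul_mem' ha hb v := mul_mem (ha v) (hb v)
  one_mem' v := one_mem (v.adicCompletionIntegers ℚ)
  add_mem' ha hb v := add_mem (ha v) (hb v)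
  zero_mem' v := zero_mem (v.adicCompletionIntegers ℚ)
  neg_mem' ha v := neg_mem (ha v)

/-- The embedding `u ↦ (1, u)` of `Ẑˣ` in the group of ideles. -/
def zHatUnits : zHatˣ →* Adeleˣ :=
  Units.map (Adele.mkHom.comp ((MonoidHom.inr ℝ FinAdele).comp zHat.subtype.toMonoidHom))

/-- The embedding `t ↦ (t, 1)` of the multiplicative group of positive reals in the group of
ideles. -/
def posReal (t : {t : ℝ // 0 < t}) : Adeleˣ :=
  Units.map (Adele.mkHom.comp (MonoidHom.inl ℝ FinAdele)) (Units.mk0 (t : ℝ) t.2.ne')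

/-- The diagonal embedding of `ℚˣ` in the group of ideles. -/
def principal : ℚˣ →* Adeleˣ := Units.map (algebraMap ℚ Adele).toMonoidHom

/-- The idele class group of `ℚ`. -/
abbrev IdeleClass := Adeleˣ ⧸ principal.range

/-- The orbit equivalence relation of the action of `Ẑˣ × ℚˣ` on the adeles. -/
instance adeleSetoid : Setoid Adele where
  r α β := ∃ (u : zHatˣ) (q : ℚˣ), (zHatUnits u * principal q : Adeleˣ) • α = β
  iseqv :=
    { refl := fun α => ⟨1, 1, by simp⟩
      symm := by
        rintro α _ ⟨u, q, rfl⟩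
        exact ⟨u⁻¹, q⁻¹, by rw [map_inv, map_inv, ← mul_inv, inv_smul_smul]⟩
      trans := by
        rintro α _ _ ⟨u, q, rfl⟩ ⟨u', q', rfl⟩
        exact ⟨u' * u, q' * q, by rw [map_mul, map_mul, mul_mul_mul_comm, mul_smul]⟩ }

/-- The quotient `Ẑˣ \ 𝔸_ℚ / ℚˣ` of the adele class space of `ℚ`. -/
abbrev AdeleClassQuotient := Quotient adeleSetoid

/-- The class of an adele. -/
abbrev adeleClass (α : Adele) : AdeleClassQuotient := Quotient.mk adeleSetoid α

/-- The action of the idele class group on `Ẑˣ \ 𝔸_ℚ / ℚˣ` induced by the multiplication. -/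
instance : MulAction IdeleClass AdeleClassQuotient where
  smul c x := Quotient.liftOn₂' c x (fun g α => adeleClass (g • α)) (by
    rintro g α g' α' hg ⟨u, q, rfl⟩
    obtain ⟨q', hq'⟩ := QuotientGroup.leftRel_apply.1 hg
    obtain rfl : g' = g * principal q' := by rw [hq', mul_inv_cancel_left]
    refine Quotient.sound ⟨u, q * q', ?_⟩
    rw [smul_smul, smul_smul, map_mul]
    congr 1
    ac_rfl)
  one_smul := by
    rintro ⟨α⟩
    exact congrArg adeleClass (one_smul Adeleˣ α)
  mul_smul := by
    rintro ⟨g⟩ ⟨h⟩ ⟨α⟩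
    exact congrArg adeleClass (mul_smul g h α)

/-- The subgroup `H_a = {q ∈ ℚ | a q ∈ Ẑ}` of `ℚ` attached to a finite adele `a`. -/
def subgroupOf (a : FinAdele) : AddSubgroup ℚ where
  carrier := {q | a * algebraMap ℚ FinAdele q ∈ zHat}
  add_mem' hq hr := by
    simp only [Set.mem_ofPred_eq, map_add, mul_add] at *
    exact add_mem hq hr
  zero_mem' := by
    simp only [Set.mem_ofPred_eq, map_zero, mul_zero]
    exact zero_mem zHat
  neg_mem' hq := by
    simp only [Set.mem_ofPred_eq, map_neg, mul_neg] at *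
    exact neg_mem hq

/-- The point `(p, f)` over `RMax` of the arithmetic site is attached to the adele
`α = (r, a) ∈ ℝ × 𝔸^f`: the point `p` is the one of the ordered group `H_a`, that is, its flat
functor is identified by some `j` with the strictly positive part of `H_a`, in such a way that `f`
becomes the morphism `H_a ∪ {-∞} → RMax`, `h ↦ exp(|r| h)`. (Since `f` is a morphism of semirings
and `RMax` is a semifield, `f` is determined by its values on the elements `h > 0`.) -/
def IsAttached (P : RMaxPoint structureSheaf) (α : Adele) : Prop :=
  ∃ j : flatSet P.point ≃ {q : ℚ // q ∈ subgroupOf α.fin ∧ 0 < q},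
    (∀ (k : ℕ+) (x : flatSet P.point), (j (flatAct P.point k x) : ℚ) = k * (j x : ℚ)) ∧
    ∀ x : flatSet P.point,
      ((P.hom (toStalk P.point x)).val : ℝ) = Real.exp (|α.real| * ((j x : ℚ) : ℝ))

end ArithSite

end

/-! Since `p^*` is a left adjoint and every presheaf is a colimit of representables, a point is
determined by the set X = p^*(y) with its action of ℕ+, and p^*F is generated by symbols s ⊗ x
(`tmul`) subject to the balancing relation. Left exactness of `p^*` amounts to flatness of X: it is
nonempty, two elements have a common divisor, and distinct integers act differently at every
element. Conversely, a flat action makes the category of elements cofiltered and so gives a point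
(`IsFlatAction.exists_equiv`).

Choosing a base point x₀ and sending x to k/l whenever x = kz and x₀ = lz embeds X in ℚ as the
positive part of a subgroup H containing 1 (`exists_subgroup_equiv`). By `equivariant_eq_mul` the
embedding is unique up to a positive rational factor. A morphism from the stalk to `RMax` restricts
on the germs at x to n ↦ exp(c(x)n) with c(x) ≥ 0, and c is equivariant, hence c = rj with r ≥ 0
(`exists_hom_eq_exp`). Points up to equivalence are therefore pairs (H, r) up to positive rational
scaling.

On the adelic side, H_a is cut out by the conditions |a_v||q|_v ≤ 1. It determines every |a_v|,
hence a up to Ẑˣ (`exists_zHat_unit_mul_eq`), and every H containing 1 is some H_a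
(`exists_subgroupOf_eq`, by localization). A rational q replaces H_a by q⁻¹H_a and r by qr; signs
are harmless because H_a = -H_a and only |r| matters. Both sides thus classify the same data.
Frobenius rescales r; that idele classes are represented in Ẑˣ × ℝ₊ˣ reflects that ℤ is principal
with unit -1. -/

noncomputable section

namespace ArithSite

/-! ### Inverse images of presheaves as tensor products with the values on representables -/

namespace ToposPoint

universe u

variable {C : Type u} [SmallCategory C] (p : ToposPoint C)

/-- The element of `p^* F` attached to a section `s ∈ F(c)` and an element of `p^*(yoneda c)`. -/
def tmul {F : Cᵒᵖ ⥤ Type u} {c : C} (s : F.obj (op c))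
    (x : p.inverseImage.obj (yoneda.obj c)) : p.inverseImage.obj F :=
  p.inverseImage.map (yonedaEquiv.symm s) x

theorem map_tmul {F G : Cᵒᵖ ⥤ Type u} (η : F ⟶ G) {c : C} (s : F.obj (op c))
    (x : p.inverseImage.obj (yoneda.obj c)) :
    p.inverseImage.map η (p.tmul s x) = p.tmul (η.app (op c) s) x := by
  unfold tmul
  rw [← yonedaEquiv_symm_naturality_right, Functor.map_comp]
  rfl

theorem tmul_map {F : Cᵒᵖ ⥤ Type u} {c d : C} (g : c ⟶ d) (s : F.obj (op d))
    (x : p.inverseImage.obj (yoneda.obj c)) :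
    p.tmul (F.map g.op s) x = p.tmul s (p.inverseImage.map (yoneda.map g) x) := by
  unfold tmul
  rw [← yonedaEquiv_symm_naturality_left, Functor.map_comp]
  rfl

theorem tmul_yoneda {c d : C} (g : c ⟶ d) (x : p.inverseImage.obj (yoneda.obj c)) :
    p.tmul (F := yoneda.obj d) g x = p.inverseImage.map (yoneda.map g) x := by
  rw [tmul, (Equiv.symm_apply_eq yonedaEquiv).2 (yonedaEquiv_yoneda_map g).symm]

/-- By adjunction a map p^*F → S is a map F → p_*S, and maps of presheaves are detected on
representables. -/
theorem hom_ext {F : Cᵒᵖ ⥤ Type u} {S : Type u} {f g : p.inverseImage.obj F ⟶ S}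
    (h : ∀ (c : C) (s : F.obj (op c)) (x : p.inverseImage.obj (yoneda.obj c)),
      f (p.tmul s x) = g (p.tmul s x)) : f = g := by
  apply (p.adj.homEquiv _ _).injective
  apply hom_ext_yoneda
  intro c s
  rw [← Adjunction.homEquiv_naturality_left, ← Adjunction.homEquiv_naturality_left]
  congr 1
  ext x
  have := h c (yonedaEquiv s) x
  rwa [tmul, Equiv.symm_apply_apply] at this

/-- The predicate "is a tensor" and the constant predicate `True` are two maps to the set of
propositions that agree on tensors, so `hom_ext` identifies them. -/
theorem exists_tmul {F : Cᵒᵖ ⥤ Type u} (t : p.inverseImage.obj F) :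
    ∃ (c : C) (s : F.obj (op c)) (x : p.inverseImage.obj (yoneda.obj c)), p.tmul s x = t := by
  have h := p.hom_ext (F := F) (S := ULift.{u} Prop)
    (f := ↾fun t => ⟨∃ (c : C) (s : F.obj (op c)) (x : p.inverseImage.obj (yoneda.obj c)),
      p.tmul s x = t⟩) (g := ↾fun _ => ⟨True⟩)
    (fun c s x => congrArg ULift.up (eq_true ⟨c, s, x, rfl⟩))
  exact of_eq_true (congrArg ULift.down (ConcreteCategory.congr_hom h t))

section Desc

variable {F : Cᵒᵖ ⥤ Type u} {S : Type u}
  (φ : ∀ c : C, F.obj (op c) → p.inverseImage.obj (yoneda.obj c) → S)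
  (hφ : ∀ (c d : C) (g : c ⟶ d) (s : F.obj (op d)) (x : p.inverseImage.obj (yoneda.obj c)),
    φ c (F.map g.op s) x = φ d s (p.inverseImage.map (yoneda.map g) x))

/-- The map out of `p^* F` given by a family of balanced maps. -/
def desc : p.inverseImage.obj F ⟶ S :=
  -- The transpose of `φ c s` is a map from the representable of c to p_*S, hence by Yoneda a
  -- section of p_*S over c; balancedness is naturality in c.
  (p.adj.homEquiv _ _).symm
    { app := fun c => ↾fun s => yonedaEquiv (p.adj.homEquiv (yoneda.obj c.unop) S (↾(φ c.unop s)))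
      naturality := by
        intro c d g
        ext s
        change yonedaEquiv (p.adj.homEquiv (yoneda.obj d.unop) S (↾(φ d.unop (F.map g s)))) =
          (p.directImage.obj S).map g
            (yonedaEquiv (p.adj.homEquiv (yoneda.obj c.unop) S (↾(φ c.unop s))))
        rw [yonedaEquiv_naturality', ← Adjunction.homEquiv_naturality_left]
        congr 2
        ext x
        exact hφ _ _ g.unop s x }

theorem desc_tmul {c : C} (s : F.obj (op c)) (x : p.inverseImage.obj (yoneda.obj c)) :
    p.desc φ hφ (p.tmul s x) = φ c s x := by
  have h : p.inverseImage.map (yonedaEquiv.symm s) ≫ p.desc φ hφ = ↾(φ c s) := by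
    unfold desc
    rw [← Adjunction.homEquiv_naturality_left_symm, Equiv.symm_apply_eq]
    apply yonedaEquiv.injective
    rw [yonedaEquiv_comp]
    simp
  exact ConcreteCategory.congr_hom h x

end Desc

variable {p} {q : ToposPoint C}

/-- A morphism of points is given by its restriction to the representable presheaves. -/
def homOfYoneda (e : yoneda ⋙ p.inverseImage ⟶ yoneda ⋙ q.inverseImage) :
    p.inverseImage ⟶ q.inverseImage where
  app F := p.desc (fun c s x => q.tmul s (e.app c x)) fun c d g s x => by
    rw [tmul_map]
    exact congrArg (q.tmul s) (ConcreteCategory.congr_hom (e.naturality g) x).symm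
  naturality F G η := by
    apply p.hom_ext
    intro c s x
    rw [ConcreteCategory.comp_apply, ConcreteCategory.comp_apply, map_tmul, desc_tmul, desc_tmul,
      map_tmul]

theorem homOfYoneda_app_tmul (e : yoneda ⋙ p.inverseImage ⟶ yoneda ⋙ q.inverseImage)
    {F : Cᵒᵖ ⥤ Type u} {c : C} (s : F.obj (op c)) (x : p.inverseImage.obj (yoneda.obj c)) :
    (homOfYoneda e).app F (p.tmul s x) = q.tmul s (e.app c x) := by
  dsimp only [homOfYoneda]
  rw [desc_tmul]

/-- An isomorphism of points is given by its restriction to the representable presheaves. -/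
def isoOfYoneda (e : yoneda ⋙ p.inverseImage ≅ yoneda ⋙ q.inverseImage) :
    p.inverseImage ≅ q.inverseImage where
  hom := homOfYoneda e.hom
  inv := homOfYoneda e.inv
  hom_inv_id := by
    ext F : 2
    apply p.hom_ext
    intro c s x
    refine (congrArg ((homOfYoneda e.inv).app F) (homOfYoneda_app_tmul e.hom s x)).trans ?_
    rw [homOfYoneda_app_tmul]
    exact congrArg (p.tmul s) (ConcreteCategory.congr_hom (e.hom_inv_id_app c) x)
  inv_hom_id := by
    ext F : 2
    apply q.hom_ext
    intro c s x
    refine (congrArg ((homOfYoneda e.hom).app F) (homOfYoneda_app_tmul e.inv s x)).trans ?_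
    rw [homOfYoneda_app_tmul]
    exact congrArg (q.tmul s) (ConcreteCategory.congr_hom (e.inv_hom_id_app c) x)

end ToposPoint

/-! ### The flat functor of a point -/

section FlatSet

variable (p : ToposPoint (SingleObj ℕ+))

theorem flatAct_one (x : flatSet p) : flatAct p 1 x = x := by
  have h : yoneda.map (SingleObj.toEnd ℕ+ 1) = 𝟙 rep := by
    rw [map_one]
    exact yoneda.map_id _
  rw [flatAct, h, CategoryTheory.Functor.map_id]
  rfl

theorem flatAct_mul (k l : ℕ+) (x : flatSet p) :
    flatAct p (k * l) x = flatAct p k (flatAct p l x) := by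
  have h : yoneda.map (SingleObj.toEnd ℕ+ (k * l)) =
      yoneda.map (SingleObj.toEnd ℕ+ l) ≫ yoneda.map (SingleObj.toEnd ℕ+ k) := by
    rw [map_mul, ← Functor.map_comp]
    rfl
  rw [flatAct, h, Functor.map_comp]
  rfl

/-- `p^*` preserves the terminal object, and the unique element of its image is a tensor over some
x. -/
theorem flatSet_nonempty : Nonempty (flatSet p) := by
  obtain ⟨_, -, x, -⟩ :=
    p.exists_tmul (default : p.inverseImage.obj (ToposPoint.terminalPresheaf (SingleObj ℕ+)))
  exact ⟨x⟩

/-- `p^*` preserves the product of the representable with itself, so the pair (x, y) is a tensor (k,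
l) ⊗ z. -/
theorem exists_common_divisor (x y : flatSet p) :
    ∃ (z : flatSet p) (k l : ℕ+), flatAct p k z = x ∧ flatAct p l z = y := by
  obtain ⟨t, rfl, rfl⟩ := p.exists_two x y
  obtain ⟨_, s, z, rfl⟩ := p.exists_tmul t
  rw [p.map_tmul, p.map_tmul]
  exact ⟨z, s.1, s.2, (p.tmul_yoneda _ z).symm, (p.tmul_yoneda _ z).symm⟩

/-- `p^*` preserves the equalizer of multiplication by k and by l. If kx = lx, this equalizer has a
section, and cancellation in ℕ+ gives k = l. -/
theorem flatAct_left_injective (x : flatSet p) : Function.Injective fun k => flatAct p k x := by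
  intro k l h
  let f : rep ⟶ rep := yoneda.map (SingleObj.toEnd ℕ+ k)
  let g : rep ⟶ rep := yoneda.map (SingleObj.toEnd ℕ+ l)
  have hl := Limits.isLimitForkMapOfIsLimit p.inverseImage _ (Limits.equalizerIsEqualizer f g)
  obtain ⟨t, -, -⟩ := (Limits.Types.type_equalizer_iff_unique _ _).1 ⟨hl⟩ x h
  obtain ⟨c, s, -, -⟩ := p.exists_tmul t
  have h1 : (Limits.equalizer.ι f g).app (op c) s ≫ SingleObj.toEnd ℕ+ k =
      (Limits.equalizer.ι f g).app (op c) s ≫ SingleObj.toEnd ℕ+ l :=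
    ConcreteCategory.congr_hom (NatTrans.congr_app (Limits.equalizer.condition f g) (op c)) s
  exact mul_right_cancel (G := ℕ+) h1

end FlatSet

/-! ### The point of a flat action -/

section PointOfAction

variable (X : Type) [MulAction ℕ+ X]

/-- The conditions on a set with an action of `ℕ+` for the associated functor to be flat. -/
structure IsFlatAction : Prop where
  nonempty : Nonempty X
  exists_common_divisor : ∀ x y : X, ∃ (z : X) (k l : ℕ+), k • z = x ∧ l • z = y
  injective : ∀ x : X, Function.Injective fun k : ℕ+ => k • x

variable {X}

/-- A morphism x → y of the category of elements is a k with k • x = y. Common divisors provide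
cones over pairs of objects, and by injectivity parallel morphisms are equal. -/
theorem IsFlatAction.isCofiltered (h : IsFlatAction X) :
    IsCofiltered (actionAsFunctor ℕ+ X).Elements where
  nonempty := h.nonempty.map fun x => ⟨SingleObj.star ℕ+, x⟩
  cone_objs := by
    rintro ⟨⟨⟩, x⟩ ⟨⟨⟩, y⟩
    obtain ⟨z, k, l, hk, hl⟩ := h.exists_common_divisor x y
    exact ⟨⟨SingleObj.star ℕ+, z⟩, ⟨k, hk⟩, ⟨l, hl⟩, trivial⟩
  cone_maps := by
    rintro ⟨⟨⟩, x⟩ ⟨⟨⟩, y⟩ ⟨k, hk⟩ ⟨l, hl⟩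
    obtain rfl : k = l := h.injective x (hk.trans hl.symm)
    exact ⟨_, 𝟙 _, rfl⟩

/-- The point of the site `(ℕ+, ⊥)` attached to a flat action. -/
def IsFlatAction.sitePoint (h : IsFlatAction X) :
    GrothendieckTopology.Point.{0} (⊥ : GrothendieckTopology (SingleObj ℕ+)) where
  fiber := actionAsFunctor ℕ+ X
  isCofiltered := h.isCofiltered
  initiallySmall := initiallySmall_of_essentiallySmall _
  jointly_surjective {U} R hR x := by
    obtain rfl : R = ⊤ := by simpa using hR
    exact ⟨U, 𝟙 _, trivial, x, one_smul (α := X) ℕ+ x⟩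

/-- The point of the topos of presheaves on `ℕ+` attached to a flat action. -/
def IsFlatAction.point (h : IsFlatAction X) : ToposPoint (SingleObj ℕ+) where
  inverseImage := h.sitePoint.presheafFiber
  directImage := h.sitePoint.skyscraperPresheafFunctor
  adj := h.sitePoint.skyscraperPresheafAdjunction
  leftExact := inferInstance

/-- Co-Yoneda: the fiber of the representable is X again. The germ of the identity at x corresponds
to x, and the germ of k at x to k • x. -/
theorem IsFlatAction.exists_equiv (h : IsFlatAction X) :
    ∃ j : flatSet h.point ≃ X, ∀ k x, j (flatAct h.point k x) = k • j x := by
  let Φ := h.sitePoint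
  let act : ℕ+ → X → X := fun k x => k • x
  let one : rep.obj (op (SingleObj.star ℕ+)) := 𝟙 (SingleObj.star ℕ+)
  let e : X → flatSet h.point := fun x => Φ.toPresheafFiber (SingleObj.star ℕ+) x rep one
  have he : ∀ (k : ℕ+) (x : X),
      Φ.toPresheafFiber (SingleObj.star ℕ+) x rep (SingleObj.toEnd ℕ+ k) = e (k • x) := by
    intro k x
    have h1 := ConcreteCategory.congr_hom (Φ.toPresheafFiber_w (SingleObj.toEnd ℕ+ k) x rep) one
    refine Eq.trans ?_ h1
    exact congrArg (Φ.toPresheafFiber (SingleObj.star ℕ+) x rep)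
      (Category.comp_id (SingleObj.toEnd ℕ+ k)).symm
  have hact : ∀ (k : ℕ+) (x : X), flatAct h.point k (e x) = e (k • x) := by
    intro k x
    rw [← he]
    have h1 := ConcreteCategory.congr_hom
      (Φ.toPresheafFiber_naturality (yoneda.map (SingleObj.toEnd ℕ+ k)) _ x) one
    refine h1.trans ?_
    exact congrArg (Φ.toPresheafFiber (SingleObj.star ℕ+) x rep)
      (Category.id_comp (SingleObj.toEnd ℕ+ k))
  have hact' : ∀ ⦃c d : SingleObj ℕ+⦄ (f : c ⟶ d) (x : Φ.fiber.obj c),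
      rep.map f.op ≫ (↾fun k => act k x) = ↾fun k => act k (Φ.fiber.map f x) := by
    intro _ _ f x
    ext k
    exact mul_smul (α := ℕ+) (β := X) k f x
  let d : flatSet h.point ⟶ X :=
    Φ.presheafFiberDesc (P := rep) (fun _ x => ↾fun k => act k x) hact'
  have hd : ∀ x : X, d (e x) = x := by
    intro x
    have h1 := ConcreteCategory.congr_hom
      (Φ.toPresheafFiber_presheafFiberDesc (P := rep) (fun _ x => ↾fun k => act k x) hact'
        (SingleObj.star ℕ+) x) one
    exact h1.trans (one_smul ℕ+ x)
  have hs : Function.Surjective e := by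
    intro t
    obtain ⟨_, x, k, rfl⟩ := Φ.toPresheafFiber_jointly_surjective (P := rep) t
    exact ⟨act k x, (he k x).symm⟩
  refine ⟨⟨d, e, fun t => ?_, hd⟩, fun k t => ?_⟩
  · obtain ⟨x, rfl⟩ := hs t
    rw [hd]
  · obtain ⟨x, rfl⟩ := hs t
    change d (flatAct h.point k (e x)) = k • d (e x)
    rw [hact, hd, hd]

end PointOfAction

/-! ### Morphisms from the tropical integers to the tropical reals -/

namespace ZMax

@[elab_as_elim]
theorem induction {motive : ZMax → Prop} (zero : motive 0)
    (coe : ∀ n : ℤ, motive (mk (n : WithBot ℤ))) (x : ZMax) : motive x := by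
  induction x using WithBot.recBotCoe with
  | bot => exact zero
  | coe n => exact coe n

theorem mk_mul_mk (m n : ℤ) : mk (m : WithBot ℤ) * mk (n : WithBot ℤ) =
    mk ((m + n : ℤ) : WithBot ℤ) := rfl

theorem mk_add_mk (m n : ℤ) : mk (m : WithBot ℤ) + mk (n : WithBot ℤ) =
    mk ((max m n : ℤ) : WithBot ℤ) := (WithBot.coe_max m n).symm

theorem one_def : (1 : ZMax) = mk ((0 : ℤ) : WithBot ℤ) := rfl

theorem frob_mk (k : ℕ+) (n : ℤ) : frob k (mk (n : WithBot ℤ)) =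
    mk (((k : ℤ) * n : ℤ) : WithBot ℤ) := rfl

end ZMax

namespace RMax

theorem ext_val {x y : RMax} (h : (x.val : ℝ) = (y.val : ℝ)) : x = y := NNReal.coe_injective h

theorem coe_val_mul (x y : RMax) : ((x * y).val : ℝ) = x.val * y.val := NNReal.coe_mul x.val y.val

theorem coe_val_add (x y : RMax) : ((x + y).val : ℝ) = max (x.val : ℝ) y.val :=
  NNReal.coe_max x.val y.val

theorem coe_val_zero : ((0 : RMax).val : ℝ) = 0 := rfl

theorem coe_val_one : ((1 : RMax).val : ℝ) = 1 := rfl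

theorem coe_val_frob (t : {t : ℝ // 0 < t}) (x : RMax) :
    ((frob t x).val : ℝ) = (x.val : ℝ) ^ (t : ℝ) := NNReal.coe_rpow x.val t

end RMax

/-- The function `n ↦ exp (c n)`, `-∞ ↦ 0` from the tropical integers to the tropical reals. -/
def expFun (c : ℝ) (x : ZMax) : RMax :=
  RMax.mk (WithBot.recBotCoe (C := fun _ => ℝ≥0) 0
    (fun n : ℤ => ⟨Real.exp (c * n), (Real.exp_pos _).le⟩) x.val)

theorem expFun_zero (c : ℝ) : expFun c 0 = 0 := rfl

theorem expFun_mk (c : ℝ) (n : ℤ) :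
    ((expFun c (ZMax.mk (n : WithBot ℤ))).val : ℝ) = Real.exp (c * n) := rfl

/-- This is the balancing relation that lets the functions `expFun (j x)` descend to the stalk when
j is equivariant. -/
theorem expFun_frob (c : ℝ) (k : ℕ+) (x : ZMax) :
    expFun c (ZMax.frob k x) = expFun (k * c) x := by
  induction x using ZMax.induction with
  | zero => rfl
  | coe n =>
    apply RMax.ext_val
    rw [ZMax.frob_mk, expFun_mk, expFun_mk]
    congr 1
    push_cast
    ring

/-- The morphism of semirings `n ↦ exp (c n)` from the tropical integers to the tropical reals. -/
def expHom (c : ℝ) (hc : 0 ≤ c) : ZMax →+* RMax where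
  toFun := expFun c
  map_zero' := rfl
  map_one' := by
    apply RMax.ext_val
    rw [ZMax.one_def, expFun_mk]
    simp [RMax.coe_val_one]
  map_mul' x y := by
    induction x using ZMax.induction with
    | zero => rw [zero_mul, expFun_zero, zero_mul]
    | coe m =>
      induction y using ZMax.induction with
      | zero => rw [mul_zero, expFun_zero, mul_zero]
      | coe n =>
        apply RMax.ext_val
        rw [ZMax.mk_mul_mk, RMax.coe_val_mul, expFun_mk, expFun_mk, expFun_mk, ← Real.exp_add]
        congr 1
        push_cast
        ring
  map_add' x y := by
    induction x using ZMax.induction with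
    | zero => rw [zero_add, expFun_zero, zero_add]
    | coe m =>
      induction y using ZMax.induction with
      | zero => rw [add_zero, expFun_zero, add_zero]
      | coe n =>
        apply RMax.ext_val
        rw [ZMax.mk_add_mk, RMax.coe_val_add, expFun_mk, expFun_mk, expFun_mk]
        have h : Monotone fun n : ℤ => Real.exp (c * n) := fun a b hab =>
          Real.exp_le_exp.2 (mul_le_mul_of_nonneg_left (Int.cast_le.2 hab) hc)
        exact h.map_max

/-- Invertible elements go to invertible elements, so log ∘ g is an additive map ℤ → ℝ and c is its
value at 1. Preservation of max(0, 1) = 1 forces c ≥ 0. -/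
theorem hom_eq_expFun (g : ZMax →+* RMax) :
    ∃ c : ℝ, 0 ≤ c ∧ ∀ n, g n = expFun c n := by
  let v : ℤ → ℝ := fun n => ((g (ZMax.mk (n : WithBot ℤ))).val : ℝ)
  have hv0 : v 0 = 1 := by
    change ((g 1).val : ℝ) = 1
    rw [map_one, RMax.coe_val_one]
  have hmul : ∀ m n, v (m + n) = v m * v n := fun m n => by
    change ((g (ZMax.mk (m : WithBot ℤ) * ZMax.mk (n : WithBot ℤ))).val : ℝ) = _
    rw [map_mul, RMax.coe_val_mul]
  have hmax : ∀ m n, v (max m n) = max (v m) (v n) := fun m n => by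
    change ((g (ZMax.mk ((max m n : ℤ) : WithBot ℤ))).val : ℝ) = _
    rw [← ZMax.mk_add_mk, map_add, RMax.coe_val_add]
  have hne : ∀ n, v n ≠ 0 := fun n h => by
    have := hmul n (-n)
    rw [add_neg_cancel, hv0, h, zero_mul] at this
    exact one_ne_zero this
  have hpos : ∀ n, 0 < v n := fun n => lt_of_le_of_ne (NNReal.coe_nonneg _) (hne n).symm
  let L : ℤ →+ ℝ := AddMonoidHom.mk' (fun n => Real.log (v n)) fun m n => by
    rw [hmul, Real.log_mul (hne m) (hne n)]
  refine ⟨L 1, Real.log_nonneg ?_, fun n => ?_⟩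
  · have := hmax 0 1
    rw [max_eq_right (by norm_num : (0 : ℤ) ≤ 1), hv0] at this
    exact max_eq_right_iff.1 this.symm
  · induction n using ZMax.induction with
    | zero => rw [map_zero, expFun_zero]
    | coe n =>
      apply RMax.ext_val
      rw [expFun_mk]
      have h : L n = L 1 * n := by
        have := map_zsmul L n 1
        rw [smul_eq_mul, mul_one] at this
        rw [this, zsmul_eq_mul, mul_comm]
      rw [← h]
      exact (Real.exp_log (hpos n)).symm

/-! ### The stalk of the structure sheaf -/

section Stalk

variable (p : ToposPoint (SingleObj ℕ+))

/-- The germ at `x` of a section of the structure sheaf. -/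
def sectionGerm (x : flatSet p) (n : ZMax) : Stalk structureSheaf p :=
  p.tmul (F := underlying structureSheaf) (c := SingleObj.star ℕ+) n x

theorem toStalk_eq (x : flatSet p) :
    toStalk p x = sectionGerm p x (ZMax.mk ((1 : ℤ) : WithBot ℤ)) := rfl

theorem exists_sectionGerm (s : Stalk structureSheaf p) : ∃ x n, sectionGerm p x n = s := by
  obtain ⟨_, n, x, rfl⟩ := p.exists_tmul (F := underlying structureSheaf) s
  exact ⟨x, n, rfl⟩

/-- With a common base element x, identities between two elements of the stalk reduce to identities
in `ZMax`. -/
theorem exists_sectionGerm_two (s t : Stalk structureSheaf p) :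
    ∃ x m n, sectionGerm p x m = s ∧ sectionGerm p x n = t := by
  obtain ⟨w, rfl, rfl⟩ := Stalk.exists_two s t
  obtain ⟨_, a, x, rfl⟩ := p.exists_tmul w
  exact ⟨x, a.1, a.2, (p.map_tmul FunctorToTypes.prod.fst a x).symm,
    (p.map_tmul FunctorToTypes.prod.snd a x).symm⟩

theorem sectionGerm_flatAct (k : ℕ+) (x : flatSet p) (n : ZMax) :
    sectionGerm p (flatAct p k x) n = sectionGerm p x (ZMax.frob k n) :=
  (p.tmul_map (F := underlying structureSheaf) (SingleObj.toEnd ℕ+ k) n x).symm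

theorem sectionGerm_eq_germ (x : flatSet p) (n : ZMax) : sectionGerm p x n =
    Stalk.germ (yonedaEquiv.symm n : rep ⟶ underlying structureSheaf) x := rfl

/-- Taking the germ at `x` is a morphism of semirings. -/
def sectionGermHom (x : flatSet p) : ZMax →+* Stalk structureSheaf p where
  toFun := sectionGerm p x
  map_zero' := by
    rw [Stalk.zero_eq x, sectionGerm_eq_germ]
    exact Stalk.germ_congr x fun _ k => map_zero (ZMax.frob k)
  map_one' := by
    rw [Stalk.one_eq x, sectionGerm_eq_germ]
    exact Stalk.germ_congr x fun _ k => map_one (ZMax.frob k)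
  map_mul' m n := by
    simp only [sectionGerm_eq_germ]
    rw [Stalk.germ_mul]
    exact Stalk.germ_congr x fun _ k => map_mul (ZMax.frob k) m n
  map_add' m n := by
    simp only [sectionGerm_eq_germ]
    rw [Stalk.germ_add]
    exact Stalk.germ_congr x fun _ k => map_add (ZMax.frob k) m n

theorem hom_sectionGerm_eq_expFun (f : Stalk structureSheaf p →+* RMax) (x : flatSet p) {c : ℝ}
    (h : ((f (toStalk p x)).val : ℝ) = Real.exp c) (n : ZMax) :
    f (sectionGerm p x n) = expFun c n := by
  obtain ⟨d, -, hd⟩ := hom_eq_expFun (f.comp (sectionGermHom p x))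
  have h1 : f (toStalk p x) = expFun d _ := hd _
  rw [h1, expFun_mk] at h
  obtain rfl : d = c := by simpa using h
  exact hd n

theorem exists_stalkHom (j : flatSet p → ℝ) (hj : ∀ k x, j (flatAct p k x) = k * j x)
    (hnonneg : ∀ x, 0 ≤ j x) :
    ∃ f : Stalk structureSheaf p →+* RMax,
      ∀ x, ((f (toStalk p x)).val : ℝ) = Real.exp (j x) := by
  let f : Stalk structureSheaf p → RMax :=
    p.desc (F := underlying structureSheaf) (S := RMax) (fun _ n x => expFun (j x) n)
      fun _ _ k n x => (expFun_frob (j x) k n).trans (congrArg (expFun · n) (hj k x).symm)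
  have hf : ∀ x n, f (sectionGerm p x n) = expFun (j x) n := fun x n =>
    p.desc_tmul (F := underlying structureSheaf) (S := RMax) _ _ n x
  refine ⟨⟨⟨⟨f, ?_⟩, ?_⟩, ?_, ?_⟩, fun x => ?_⟩
  · obtain ⟨x⟩ := flatSet_nonempty p
    rw [← map_one (sectionGermHom p x)]
    exact (hf x 1).trans (map_one (expHom (j x) (hnonneg x)))
  · intro s t
    obtain ⟨x, m, n, rfl, rfl⟩ := exists_sectionGerm_two p s t
    refine (congrArg f (map_mul (sectionGermHom p x) m n).symm).trans ?_
    refine (hf x (m * n)).trans ((map_mul (expHom (j x) (hnonneg x)) m n).trans ?_)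
    exact congrArg₂ (· * ·) (hf x m).symm (hf x n).symm
  · obtain ⟨x⟩ := flatSet_nonempty p
    refine (congrArg f (map_zero (sectionGermHom p x)).symm).trans ?_
    exact hf x 0
  · intro s t
    obtain ⟨x, m, n, rfl, rfl⟩ := exists_sectionGerm_two p s t
    refine (congrArg f (map_add (sectionGermHom p x) m n).symm).trans ?_
    refine (hf x (m + n)).trans ((map_add (expHom (j x) (hnonneg x)) m n).trans ?_)
    exact congrArg₂ (· + ·) (hf x m).symm (hf x n).symm
  · change ((f (toStalk p x)).val : ℝ) = _
    rw [toStalk_eq, hf, expFun_mk]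
    simp

end Stalk

/-! ### The rank one group of a point -/

section RankOne

variable (p : ToposPoint (SingleObj ℕ+))

/-- Two equivariant functions are proportional: compare both at a common divisor of x and y. This
gives the uniqueness of the rank one group up to scaling. -/
theorem equivariant_eq_mul {K : Type*} [Field K] [CharZero K] {i j : flatSet p → K}
    (hi : ∀ k x, i (flatAct p k x) = k * i x) (hj : ∀ k x, j (flatAct p k x) = k * j x)
    (x y : flatSet p) : i x * j y = i y * j x := by
  obtain ⟨z, k, l, rfl, rfl⟩ := exists_common_divisor p x y
  rw [hi, hi, hj, hj]
  ring

theorem exists_equivariant (x₀ : flatSet p) : ∃ j : flatSet p → ℚ,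
    (∀ k x, j (flatAct p k x) = k * j x) ∧ (∀ x, 0 < j x) ∧ Function.Injective j ∧ j x₀ = 1 := by
  have hone : ∀ k : ℕ+, ((k : ℕ) : ℚ) ≠ 0 := fun k => by exact_mod_cast k.ne_zero
  -- The fraction k/l depends only on kz, and determines it, once lz = x₀. Equivariance, injectivity
  -- and normalization at x₀ all follow from this.
  have huniq : ∀ (z z' : flatSet p) (k l k' l' : ℕ+), flatAct p l z = x₀ → flatAct p l' z' = x₀ →
      (flatAct p k z = flatAct p k' z' ↔ ((k : ℕ) : ℚ) / l = (k' : ℕ) / l') := by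
    intro z z' k l k' l' h h'
    obtain ⟨w, m, m', rfl, rfl⟩ := exists_common_divisor p z z'
    simp only [← flatAct_mul] at h h' ⊢
    have h2 : l * m = l' * m' := flatAct_left_injective p w (h.trans h'.symm)
    have h3 : ((l : ℕ) : ℚ) * m = l' * m' := by exact_mod_cast h2
    rw [(flatAct_left_injective p w).eq_iff, div_eq_div_iff (hone l) (hone l')]
    have h4 : (k * m = k' * m') ↔ ((k : ℕ) : ℚ) * m = k' * m' := by exact_mod_cast Iff.rfl
    rw [h4]
    constructor
    · intro h5
      apply mul_right_cancel₀ (hone m)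
      apply mul_right_cancel₀ (hone m')
      linear_combination (l' : ℚ) * m' * h5 - (k' : ℚ) * m' * h3
    · intro h5
      apply mul_right_cancel₀ (hone l')
      linear_combination (m : ℚ) * h5 + (k' : ℚ) * h3
  choose z k l hk hl using fun x => exists_common_divisor p x x₀
  refine ⟨fun x => (k x : ℕ) / (l x : ℕ), fun n x => ?_, fun x => ?_, fun x y h => ?_, ?_⟩
  · have h := (huniq (z (flatAct p n x)) (z x) (k (flatAct p n x)) (l (flatAct p n x)) (n * k x)
      (l x) (hl _) (hl _)).1 (by rw [hk, flatAct_mul, hk])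
    refine h.trans ?_
    push_cast
    ring
  · have h1 := (k x).pos
    have h2 := (l x).pos
    positivity
  · have h1 := (huniq _ _ (k x) (l x) (k y) (l y) (hl x) (hl y)).2 h
    rwa [hk, hk] at h1
  · have h := (huniq (z x₀) x₀ (k x₀) (l x₀) 1 1 (hl _) (flatAct_one p _)).1
      (by rw [hk, flatAct_one])
    exact h.trans (by simp)

/-- The integer multiples of values of j are closed under addition thanks to common divisors. A
positive one is n j(x) = j(nx) with n > 0, so j reaches all of the positive part. -/
theorem exists_subgroup_equiv : ∃ (H : AddSubgroup ℚ) (j : flatSet p ≃ {q : ℚ // q ∈ H ∧ 0 < q}),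
    1 ∈ H ∧ ∀ (k : ℕ+) (x : flatSet p), (j (flatAct p k x) : ℚ) = k * (j x : ℚ) := by
  obtain ⟨x₀⟩ := flatSet_nonempty p
  obtain ⟨j, hj, hpos, hinj, h1⟩ := exists_equivariant p x₀
  let H : AddSubgroup ℚ :=
    { carrier := {q | ∃ (x : flatSet p) (n : ℤ), q = n * j x}
      zero_mem' := ⟨x₀, 0, by simp⟩
      add_mem' := by
        rintro _ _ ⟨x, m, rfl⟩ ⟨y, n, rfl⟩
        obtain ⟨z, k, l, rfl, rfl⟩ := exists_common_divisor p x y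
        refine ⟨z, m * k + n * l, ?_⟩
        rw [hj, hj]
        push_cast
        ring
      neg_mem' := by
        rintro _ ⟨x, n, rfl⟩
        exact ⟨x, -n, by push_cast; ring⟩ }
  have hmem : ∀ x, j x ∈ H := fun x => ⟨x, 1, by simp⟩
  refine ⟨H, Equiv.ofBijective (fun x => ⟨j x, hmem x, hpos x⟩) ⟨fun x y h => ?_, ?_⟩, ?_, ?_⟩
  · exact hinj (congrArg Subtype.val h)
  · rintro ⟨_, ⟨x, n, rfl⟩, hn⟩
    have hn' : 0 < n := by
      have := (mul_pos_iff_of_pos_right (hpos x)).1 hn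
      exact_mod_cast this
    lift n to ℕ using hn'.le
    refine ⟨flatAct p ⟨n, by exact_mod_cast hn'⟩ x, Subtype.ext ?_⟩
    exact hj _ x
  · rw [← h1]
    exact hmem x₀
  · exact hj

/-- The exponent c(x) of f on the germs at x is itself equivariant in x, hence proportional to j. -/
theorem exists_hom_eq_exp (f : Stalk structureSheaf p →+* RMax) {j : flatSet p → ℝ}
    (hj : ∀ k x, j (flatAct p k x) = k * j x) (hpos : ∀ x, 0 < j x) :
    ∃ r : ℝ, 0 ≤ r ∧ ∀ x, ((f (toStalk p x)).val : ℝ) = Real.exp (r * j x) := by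
  choose c hc hf using fun x => hom_eq_expFun (f.comp (sectionGermHom p x))
  have hval : ∀ x, ((f (toStalk p x)).val : ℝ) = Real.exp (c x) := fun x => by
    have h1 : f (toStalk p x) = expFun (c x) _ := hf x _
    rw [h1, expFun_mk]
    simp
  have hact : ∀ k x, c (flatAct p k x) = k * c x := fun k x => by
    apply Real.exp_injective
    rw [← hval, toStalk_eq, sectionGerm_flatAct, hom_sectionGerm_eq_expFun p f x (hval x),
      expFun_frob, expFun_mk]
    simp
  obtain ⟨x₀⟩ := flatSet_nonempty p
  refine ⟨c x₀ / j x₀, div_nonneg (hc _) (hpos _).le, fun x => ?_⟩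
  rw [hval, div_mul_eq_mul_div, equivariant_eq_mul p hact hj x₀ x,
    mul_div_cancel_right₀ _ (hpos x₀).ne']

end RankOne

/-! ### Comparison of points -/

/-- An isomorphism of points is determined by X, and a morphism on the stalk by its values on the
image of X. -/
theorem equiv_of_flatSet_equiv {P Q : RMaxPoint structureSheaf}
    (e : flatSet P.point ≃ flatSet Q.point)
    (he : ∀ k x, e (flatAct P.point k x) = flatAct Q.point k (e x))
    (hhom : ∀ x, Q.hom (toStalk Q.point (e x)) = P.hom (toStalk P.point x)) :
    P ≈ Q := by
  let ε : yoneda ⋙ P.point.inverseImage ≅ yoneda ⋙ Q.point.inverseImage :=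
    NatIso.ofComponents (fun _ => e.toIso) fun k => by
      ext x
      exact he k x
  refine ⟨ToposPoint.isoOfYoneda ε, fun s => ?_⟩
  obtain ⟨x, n, rfl⟩ := exists_sectionGerm P.point s
  have h1 : (ToposPoint.isoOfYoneda ε).hom.app (underlying structureSheaf)
      (sectionGerm P.point x n) = sectionGerm Q.point (e x) n :=
    ToposPoint.homOfYoneda_app_tmul (F := underlying structureSheaf) ε.hom n x
  obtain ⟨c, -, hc⟩ := hom_eq_expFun (P.hom.comp (sectionGermHom P.point x))
  have hP : ((P.hom (toStalk P.point x)).val : ℝ) = Real.exp c := by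
    have h1 : P.hom (toStalk P.point x) = expFun c _ := hc _
    rw [h1, expFun_mk]
    simp
  rw [h1, hom_sectionGerm_eq_expFun _ P.hom x hP,
    hom_sectionGerm_eq_expFun _ Q.hom (e x) ((hhom x).symm ▸ hP)]

theorem equiv_of_isAttached {P Q : RMaxPoint structureSheaf} {α : Adele} (hP : IsAttached P α)
    (hQ : IsAttached Q α) : P ≈ Q := by
  obtain ⟨i, hi, hi'⟩ := hP
  obtain ⟨j, hj, hj'⟩ := hQ
  refine equiv_of_flatSet_equiv (i.trans j.symm) (fun k x => ?_) fun x => ?_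
  · apply j.injective
    apply Subtype.ext
    simp [hi, hj]
  · apply RMax.ext_val
    rw [hi', hj']
    simp

theorem IsAttached.of_equiv {P Q : RMaxPoint structureSheaf} {α : Adele} (h : P ≈ Q)
    (hP : IsAttached P α) : IsAttached Q α := by
  obtain ⟨φ, hφ⟩ := h
  obtain ⟨j, hj, hj'⟩ := hP
  have hnat : ∀ {F G : (SingleObj ℕ+)ᵒᵖ ⥤ Type} (η : F ⟶ G) x,
      φ.hom.app G (P.point.inverseImage.map η x) = Q.point.inverseImage.map η (φ.hom.app F x) :=
    fun η x => ConcreteCategory.congr_hom (φ.hom.naturality η) x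
  let e : flatSet P.point ≃ flatSet Q.point := (φ.app rep).toEquiv
  refine ⟨e.symm.trans j, fun k y => ?_, fun y => ?_⟩
  · obtain ⟨x, rfl⟩ := e.surjective y
    have h1 : flatAct Q.point k (e x) = e (flatAct P.point k x) := (hnat _ x).symm
    rw [h1]
    simp [hj]
  · obtain ⟨x, rfl⟩ := e.surjective y
    have h1 : toStalk Q.point (e x) =
        φ.hom.app (underlying structureSheaf) (toStalk P.point x) := (hnat unitSection x).symm
    rw [h1]
    refine (congrArg (fun y : RMax => (y.val : ℝ)) (hφ (toStalk P.point x))).trans ?_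
    simp [hj']

open IsDedekindDomain

/-! ### Valuations of rational numbers and of finite adeles -/

/-- Each prime ideal of ℤ is principal, so a product of powers of generators has the prescribed
valuations; the absolute value makes it positive. -/
theorem exists_rat_valuation_eq (n : HeightOneSpectrum ℤ → ℤ) (hn : {v | n v ≠ 0}.Finite) :
    ∃ q : ℚ, 0 < q ∧ ∀ v : HeightOneSpectrum ℤ, v.valuation ℚ q = WithZero.exp (n v) := by
  classical
  have hgen : ∀ v : HeightOneSpectrum ℤ, ∃ g : ℤ, g ≠ 0 ∧ v.asIdeal = Ideal.span {g} := fun v => by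
    obtain ⟨g, hg⟩ := IsPrincipalIdealRing.principal v.asIdeal
    refine ⟨g, fun h => v.ne_bot ?_, hg⟩
    rw [hg, h]
    simp
  choose g hg0 hg using hgen
  have hval : ∀ v w : HeightOneSpectrum ℤ,
      v.valuation ℚ (g w : ℚ) = if v = w then WithZero.exp (-1 : ℤ) else 1 := fun v w => by
    have h1 : v.valuation ℚ (g w : ℚ) = v.intValuation (g w) := v.valuation_of_algebraMap (g w)
    rw [h1]
    split_ifs with h
    · subst h
      exact v.intValuation_singleton (hg0 v) (hg v)
    · rw [HeightOneSpectrum.intValuation_eq_one_iff]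
      intro hmem
      apply h
      have hle : w.asIdeal ≤ v.asIdeal := by
        rw [hg w, Ideal.span_singleton_le_iff_mem]
        exact hmem
      exact HeightOneSpectrum.ext (w.isMaximal.eq_of_le v.isPrime.ne_top hle).symm
  let q : ℚ := ∏ w ∈ hn.toFinset, (g w : ℚ) ^ (-n w)
  have hq : q ≠ 0 := Finset.prod_ne_zero_iff.2 fun w _ =>
    zpow_ne_zero _ (Int.cast_ne_zero.2 (hg0 w))
  have hqv : ∀ v : HeightOneSpectrum ℤ, v.valuation ℚ q = WithZero.exp (n v) := fun v => by
    simp only [q, map_prod, map_zpow₀, hval]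
    have h1 : ∀ w ∈ hn.toFinset, (if v = w then WithZero.exp (-1 : ℤ) else 1) ^ (-n w) =
        if v = w then WithZero.exp (n v) else 1 := fun w _ => by
      split_ifs with h
      · subst h
        rw [← WithZero.exp_zsmul]
        simp
      · exact one_zpow _
    rw [Finset.prod_congr rfl h1, Finset.prod_ite_eq]
    split_ifs with h
    · rfl
    · have : n v = 0 := by simpa using h
      rw [this, WithZero.exp_zero]
  refine ⟨|q|, abs_pos.2 hq, fun v => ?_⟩
  rcases abs_choice q with h | h
  · rw [h, hqv]
  · rw [h, Valuation.map_neg, hqv]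

theorem finAdele_mul_apply (a b : FinAdele) (v : HeightOneSpectrum ℤ) :
    (a * b) v = a v * b v := rfl

theorem valued_algebraMap (q : ℚ) (v : HeightOneSpectrum ℤ) :
    Valued.v (algebraMap ℚ FinAdele q v) = v.valuation ℚ q :=
  HeightOneSpectrum.valuedAdicCompletion_eq_valuation' v q

theorem mem_subgroupOf {a : FinAdele} {q : ℚ} :
    q ∈ subgroupOf a ↔ ∀ v : HeightOneSpectrum ℤ, Valued.v (a v) * v.valuation ℚ q ≤ 1 := by
  refine forall_congr' fun v => ?_
  change Valued.v ((a * algebraMap ℚ FinAdele q) v) ≤ 1 ↔ _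
  rw [finAdele_mul_apply, map_mul, valued_algebraMap]

theorem finite_one_lt_valued (a : FinAdele) :
    {v : HeightOneSpectrum ℤ | 1 < Valued.v (a v)}.Finite := by
  have h : ∀ᶠ v in Filter.cofinite, a v ∈ v.adicCompletionIntegers ℚ := a.2
  rw [Filter.eventually_cofinite] at h
  refine h.subset fun v hv => ?_
  exact (HeightOneSpectrum.notMem_adicCompletionIntegers ℤ ℚ v).2 hv

theorem exists_mem_subgroupOf_valuation_eq (a : FinAdele) (v : HeightOneSpectrum ℤ) (n : ℤ)
    (h : Valued.v (a v) * WithZero.exp n ≤ 1) :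
    ∃ q ∈ subgroupOf a, v.valuation ℚ q = WithZero.exp n := by
  classical
  -- Away from v, q only has to cancel the finitely many poles of a.
  let m : HeightOneSpectrum ℤ → ℤ := fun w =>
    if w = v then n else if 1 < Valued.v (a w) then -WithZero.log (Valued.v (a w)) else 0
  have hm : {w | m w ≠ 0}.Finite := by
    refine ((Set.finite_singleton v).union (finite_one_lt_valued a)).subset fun w hw => ?_
    by_contra hcon
    rw [Set.mem_union, not_or] at hcon
    have h1 : w ≠ v := hcon.1
    have h2 : ¬ 1 < Valued.v (a w) := hcon.2
    exact hw (by simp only [m, if_neg h1, if_neg h2])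
  obtain ⟨q, -, hqv⟩ := exists_rat_valuation_eq m hm
  refine ⟨q, mem_subgroupOf.2 fun w => ?_, ?_⟩
  · rw [hqv]
    by_cases h1 : w = v
    · subst h1
      simpa [m] using h
    · simp only [m, if_neg h1]
      split_ifs with h2
      · have h3 : Valued.v (a w) ≠ 0 := (zero_lt_one.trans h2).ne'
        rw [WithZero.exp_neg, WithZero.exp_log h3, mul_inv_cancel₀ h3]
      · simpa using h2
  · rw [hqv]
    simp [m]

theorem valued_le_of_subgroupOf_le {a b : FinAdele} (h : subgroupOf a ≤ subgroupOf b)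
    (v : HeightOneSpectrum ℤ) : Valued.v (b v) ≤ Valued.v (a v) := by
  by_contra! hlt
  have hb : Valued.v (b v) ≠ 0 := (zero_le.trans_lt hlt).ne'
  -- The exponent is chosen so that |b_v||q|_v is one step above 1. Since |a_v| < |b_v| and the
  -- value group is discrete, |a_v||q|_v ≤ 1 still holds.
  obtain ⟨q, hq, hqv⟩ := exists_mem_subgroupOf_valuation_eq a v
    (1 - WithZero.log (Valued.v (b v))) (by
      rw [sub_eq_neg_add, WithZero.exp_add, WithZero.exp_neg, WithZero.exp_log hb, ← mul_assoc]
      have h1 : Valued.v (a v) * (Valued.v (b v))⁻¹ < 1 := by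
        rw [← div_eq_mul_inv]
        exact (div_lt_one₀ (zero_lt_iff.2 hb)).2 hlt
      rw [← WithZero.lt_mul_exp_iff_le one_ne_zero, one_mul]
      exact mul_lt_of_lt_one_left WithZero.exp_pos h1)
  have h2 := mem_subgroupOf.1 (h hq) v
  rw [hqv, sub_eq_neg_add, WithZero.exp_add, WithZero.exp_neg, WithZero.exp_log hb, ← mul_assoc,
    mul_inv_cancel₀ hb, one_mul, ← WithZero.exp_zero, WithZero.exp_le_exp] at h2
  omega

theorem valued_zHat_unit (u : zHatˣ) (v : HeightOneSpectrum ℤ) :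
    Valued.v (((u : zHat) : FinAdele) v) = 1 := by
  have h : Valued.v (((u : zHat) : FinAdele) v) * Valued.v (((u⁻¹ : zHatˣ) : zHat).1 v) = 1 := by
    have h1 : ((u : zHat) : FinAdele) * ((u⁻¹ : zHatˣ) : zHat).1 = 1 :=
      congrArg Subtype.val u.mul_inv
    rw [← map_mul, ← finAdele_mul_apply, h1]
    exact map_one _
  refine le_antisymm ((u : zHat).2 v) ?_
  rw [← h]
  exact mul_le_of_le_one_right' (((u⁻¹ : zHatˣ) : zHat).2 v)

theorem exists_zHat_unit (x : ∀ v : HeightOneSpectrum ℤ, v.adicCompletion ℚ)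
    (hx : ∀ v, Valued.v (x v) = 1) :
    ∃ u : zHatˣ, ∀ v, ((u : zHat) : FinAdele) v = x v := by
  have hx' : ∀ v, Valued.v (x v)⁻¹ = 1 := fun v => by rw [map_inv₀, hx, inv_one]
  have h0 : ∀ v, x v ≠ 0 := fun v h => by simpa [h] using hx v
  let a : FinAdele := ⟨x, Filter.Eventually.of_forall fun v => (hx v).le⟩
  let b : FinAdele := ⟨fun v => (x v)⁻¹, Filter.Eventually.of_forall fun v => (hx' v).le⟩
  have hab : a * b = 1 := FiniteAdeleRing.ext _ fun v => mul_inv_cancel₀ (h0 v)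
  exact ⟨⟨⟨a, fun v => (hx v).le⟩, ⟨b, fun v => (hx' v).le⟩, Subtype.ext hab,
    Subtype.ext ((mul_comm b a).trans hab)⟩, fun _ => rfl⟩

theorem subgroupOf_zHat_unit_mul (u : zHatˣ) (a : FinAdele) :
    subgroupOf ((u : zHat) * a) = subgroupOf a := by
  ext q
  rw [mem_subgroupOf, mem_subgroupOf]
  refine forall_congr' fun v => ?_
  rw [finAdele_mul_apply, map_mul, valued_zHat_unit, one_mul]

theorem mem_subgroupOf_algebraMap_mul {a : FinAdele} {q r : ℚ} :
    r ∈ subgroupOf (algebraMap ℚ FinAdele q * a) ↔ q * r ∈ subgroupOf a := by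
  change algebraMap ℚ FinAdele q * a * algebraMap ℚ FinAdele r ∈ zHat ↔
    a * algebraMap ℚ FinAdele (q * r) ∈ zHat
  rw [map_mul, mul_left_comm, mul_assoc]

/-- Equal subgroups force |a_v| = |b_v| everywhere, so b_v/a_v is a local unit; where a_v vanishes
so does b_v, and 1 serves. -/
theorem exists_zHat_unit_mul_eq {a b : FinAdele} (h : subgroupOf a = subgroupOf b) :
    ∃ u : zHatˣ, ((u : zHat) : FinAdele) * a = b := by
  classical
  have hv : ∀ v, Valued.v (a v) = Valued.v (b v) := fun v =>
    le_antisymm (valued_le_of_subgroupOf_le h.ge v) (valued_le_of_subgroupOf_le h.le v)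
  have h0 : ∀ v, a v = 0 → b v = 0 := fun v ha => by
    have := hv v
    rw [ha, map_zero] at this
    exact (map_eq_zero _).1 this.symm
  obtain ⟨u, hu⟩ := exists_zHat_unit (fun v => if a v = 0 then 1 else b v / a v) fun v => by
    split_ifs with ha
    · exact map_one _
    · rw [map_div₀, ← hv v, div_self ((map_ne_zero _).2 ha)]
  refine ⟨u, FiniteAdeleRing.ext _ fun v => ?_⟩
  rw [finAdele_mul_apply, hu]
  split_ifs with ha
  · rw [ha, h0 v ha, mul_zero]
  · exact div_mul_cancel₀ _ ha

/-- A subgroup of ℚ is the intersection of its localizations. At v, take the inverse of an element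
of H of largest valuation, or 0 if there is none; because 1 ∈ H, the result is integral at every
place. -/
theorem exists_subgroupOf_eq {H : AddSubgroup ℚ} (h1 : 1 ∈ H) :
    ∃ a : FinAdele, subgroupOf a = H := by
  let B : HeightOneSpectrum ℤ → Prop := fun v =>
    ∃ h ∈ H, ∀ g ∈ H, v.valuation ℚ g ≤ v.valuation ℚ h
  have hB : ∀ v : HeightOneSpectrum ℤ, ∃ x : v.adicCompletion ℚ, Valued.v x ≤ 1 ∧
      (∀ g ∈ H, Valued.v x * v.valuation ℚ g ≤ 1) ∧
      ∀ q : ℚ, Valued.v x * v.valuation ℚ q ≤ 1 → ∃ g ∈ H, v.valuation ℚ q ≤ v.valuation ℚ g := by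
    intro v
    by_cases hv : B v
    · obtain ⟨h, hh, hmax⟩ := hv
      have hone : 1 ≤ v.valuation ℚ h := by simpa using hmax 1 h1
      have hpos : 0 < v.valuation ℚ h := zero_lt_one.trans_le hone
      refine ⟨algebraMap ℚ FinAdele h⁻¹ v, ?_⟩
      rw [valued_algebraMap, map_inv₀]
      refine ⟨inv_le_one_of_one_le₀ hone, fun g hg => ?_, fun q hq => ⟨h, hh, ?_⟩⟩
      · exact (inv_mul_le_one₀ hpos).2 (hmax g hg)
      · exact (inv_mul_le_one₀ hpos).1 hq
    · refine ⟨0, by simp, by simp, fun q _ => ?_⟩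
      by_contra! hcon
      apply hv
      have hq : v.valuation ℚ q ≠ 0 := (zero_le.trans_lt (hcon 1 h1)).ne'
      -- If q bounded the valuations on H, discreteness would make their maximum attained, contrary
      -- to `hv`.
      obtain ⟨m, ⟨h, hh, hh0, hm⟩, hmax⟩ := Int.exists_greatest_of_bdd
        (P := fun m => ∃ h ∈ H, h ≠ 0 ∧ WithZero.log (v.valuation ℚ h) = m)
        ⟨WithZero.log (v.valuation ℚ q), by
          rintro _ ⟨h, hh, hh0, rfl⟩
          exact (WithZero.log_le_log ((map_ne_zero _).2 hh0) hq).2 (hcon h hh).le⟩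
        ⟨_, 1, h1, one_ne_zero, rfl⟩
      refine ⟨h, hh, fun g hg => ?_⟩
      by_cases hg0 : g = 0
      · simp [hg0]
      · rw [← WithZero.log_le_log ((map_ne_zero _).2 hg0) ((map_ne_zero _).2 hh0), hm]
        exact hmax _ ⟨g, hg, hg0, rfl⟩
  choose x hx1 hx2 hx3 using hB
  refine ⟨⟨x, Filter.Eventually.of_forall hx1⟩, le_antisymm (fun q hq => ?_) fun q hq =>
    mem_subgroupOf.2 fun v => hx2 v q hq⟩
  have hq' := mem_subgroupOf.1 hq
  -- The ideal of integers carrying q into H. If proper, it lies in some maximal M, nonzero because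
  -- the denominator of q is in I. At that place, q is v-integral over some g ∈ H, so dq = ng with d
  -- outside M; yet d lies in I.
  let I : Ideal ℤ :=
    { carrier := {n | (n : ℚ) * q ∈ H}
      zero_mem' := by simp
      add_mem' := fun {m n} hm hn => by
        have := add_mem (S := AddSubgroup ℚ) hm hn
        simpa [add_mul] using this
      smul_mem' := fun m n hn => by
        have := zsmul_mem (S := AddSubgroup ℚ) hn m
        simpa [mul_assoc] using this }
  have hI : I = ⊤ := by
    by_contra hI
    obtain ⟨M, hM, hIM⟩ := Ideal.exists_le_maximal I hI
    have hMbot : M ≠ ⊥ := fun h => by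
      subst h
      have h2 : ((q.den : ℕ) : ℤ) ∈ I := by
        change ((q.den : ℤ) : ℚ) * q ∈ H
        have h3 := zsmul_mem h1 q.num
        rw [Int.cast_natCast, Rat.den_mul_eq_num]
        simpa using h3
      have h4 := hIM h2
      simp at h4
    let v : HeightOneSpectrum ℤ := ⟨M, hM.isPrime, hMbot⟩
    obtain ⟨g, hg, hqg⟩ := hx3 v q (hq' v)
    by_cases hg0 : g = 0
    · have hq0 : q = 0 := by simpa [hg0] using hqg
      apply hI
      rw [Ideal.eq_top_iff_one]
      change ((1 : ℤ) : ℚ) * q ∈ H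
      simp [hq0]
    obtain ⟨n, ⟨d, hd⟩, hnd⟩ := v.exists_primeCompl_mul_eq_of_integer (q / g) (by
      rw [map_div₀]
      exact div_le_one_of_le₀ hqg zero_le)
    apply hd
    apply hIM
    change ((d : ℤ) : ℚ) * q ∈ H
    have h5 : (d : ℚ) * q = n * g := by
      have h6 : q / g * (d : ℚ) = n := hnd
      field_simp at h6
      linarith
    rw [h5, ← zsmul_eq_mul]
    exact zsmul_mem hg n
  have h7 : (1 : ℤ) ∈ I := hI ▸ Submodule.mem_top
  have h8 : ((1 : ℤ) : ℚ) * q ∈ H := h7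
  simpa using h8

/-- Class number one: the valuations of a finite idele are almost all trivial and are cancelled by a
positive rational. -/
theorem exists_algebraMap_mul_eq_zHat_unit (a : FinAdeleˣ) :
    ∃ (q : ℚ) (u : zHatˣ), 0 < q ∧
      algebraMap ℚ FinAdele q * (a : FinAdele) = ((u : zHat) : FinAdele) := by
  obtain ⟨h0, h1⟩ := FiniteAdeleRing.isUnit_iff.1 a.isUnit
  have hne : ∀ v, Valued.v ((a : FinAdele) v) ≠ 0 := fun v => (map_ne_zero _).2 (h0 v)
  obtain ⟨q, hq, hqv⟩ := exists_rat_valuation_eq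
    (fun v => -WithZero.log (Valued.v ((a : FinAdele) v))) (by
      rw [Filter.eventually_cofinite] at h1
      refine h1.subset fun v hv h2 => hv ?_
      simp [h2])
  obtain ⟨u, hu⟩ := exists_zHat_unit (fun v => (algebraMap ℚ FinAdele q * (a : FinAdele)) v)
    fun v => by
      rw [finAdele_mul_apply, map_mul, valued_algebraMap, hqv, WithZero.exp_neg,
        WithZero.exp_log (hne v), inv_mul_cancel₀ (hne v)]
  exact ⟨q, u, hq, FiniteAdeleRing.ext _ fun v => (hu v).symm⟩

/-! ### Components of adeles -/

namespace Adele

theorem ext_components {α β : Adele} (hr : α.real = β.real) (hf : α.fin = β.fin) : α = β :=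
  Prod.ext (realEquiv.injective hr) hf

theorem real_mk (r : ℝ) (a : FinAdele) : (mk r a).real = r := realEquiv.apply_symm_apply r

theorem fin_mk (r : ℝ) (a : FinAdele) : (mk r a).fin = a := rfl

theorem real_mul (α β : Adele) : (α * β).real = α.real * β.real := map_mul realEquiv α.1 β.1

theorem fin_mul (α β : Adele) : (α * β).fin = α.fin * β.fin := rfl

theorem real_zHatUnits (u : zHatˣ) : (zHatUnits u : Adele).real = 1 := real_mk 1 _

theorem fin_zHatUnits (u : zHatˣ) : (zHatUnits u : Adele).fin = ((u : zHat) : FinAdele) := rfl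

theorem real_posReal (t : {t : ℝ // 0 < t}) : (posReal t : Adele).real = t := real_mk _ _

theorem fin_posReal (t : {t : ℝ // 0 < t}) : (posReal t : Adele).fin = 1 := rfl

/-- There is only one ring morphism from ℚ to ℝ. -/
theorem real_principal (q : ℚˣ) : (principal q : Adele).real = ((q : ℚ) : ℝ) :=
  eq_ratCast ((realEquiv : NumberField.InfiniteAdeleRing ℚ →+* ℝ).comp
    ((RingHom.fst (NumberField.InfiniteAdeleRing ℚ) FinAdele).comp (algebraMap ℚ Adele))) (q : ℚ)

theorem fin_principal (q : ℚˣ) : (principal q : Adele).fin = algebraMap ℚ FinAdele q := rfl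

end Adele

theorem adele_equiv_iff {α β : Adele} : α ≈ β ↔ ∃ (u : zHatˣ) (q : ℚˣ),
    ((q : ℚ) : ℝ) * α.real = β.real ∧
      ((u : zHat) : FinAdele) * (algebraMap ℚ FinAdele q * α.fin) = β.fin := by
  refine exists_congr fun u => exists_congr fun q => ?_
  rw [Units.smul_def, smul_eq_mul, Units.val_mul]
  constructor
  · rintro rfl
    rw [Adele.real_mul, Adele.real_mul, Adele.fin_mul, Adele.fin_mul, Adele.real_zHatUnits,
      Adele.fin_zHatUnits, Adele.real_principal, Adele.fin_principal, one_mul, mul_assoc]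
    exact ⟨rfl, rfl⟩
  · rintro ⟨h1, h2⟩
    apply Adele.ext_components
    · rw [Adele.real_mul, Adele.real_mul, Adele.real_zHatUnits, Adele.real_principal, one_mul, h1]
    · rw [Adele.fin_mul, Adele.fin_mul, Adele.fin_zHatUnits, Adele.fin_principal, mul_assoc, h2]

/-! ### The correspondence between points and adeles -/

theorem exists_isAttached (P : RMaxPoint structureSheaf) : ∃ α, IsAttached P α := by
  obtain ⟨H, j, h1, hj⟩ := exists_subgroup_equiv P.point
  obtain ⟨a, rfl⟩ := exists_subgroupOf_eq h1
  obtain ⟨r, hr, hf⟩ := exists_hom_eq_exp P.point P.hom (j := fun x => ((j x : ℚ) : ℝ))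
    (fun k x => by rw [hj]; push_cast; rfl) fun x => by exact_mod_cast (j x).2.2
  refine ⟨Adele.mk r a, j, hj, fun x => ?_⟩
  rw [hf, Adele.real_mk, abs_of_nonneg hr]
  rfl

theorem exists_pos_mem_subgroupOf (a : FinAdele) : ∃ q ∈ subgroupOf a, 0 < q := by
  classical
  obtain ⟨q, hq, hqv⟩ := exists_rat_valuation_eq
    (fun v => if 1 < Valued.v (a v) then -WithZero.log (Valued.v (a v)) else 0)
    ((finite_one_lt_valued a).subset fun v hv => by
      by_contra h
      exact hv (if_neg h))
  refine ⟨q, mem_subgroupOf.2 fun v => ?_, hq⟩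
  rw [hqv]
  split_ifs with h
  · have h0 : Valued.v (a v) ≠ 0 := (zero_lt_one.trans h).ne'
    rw [WithZero.exp_neg, WithZero.exp_log h0, mul_inv_cancel₀ h0]
  · simpa using h

/-- Multiplication of the positive elements of a subgroup of `ℚ` by positive integers. -/
instance positivePartAction (H : AddSubgroup ℚ) : MulAction ℕ+ {q : ℚ // q ∈ H ∧ 0 < q} where
  smul k q := ⟨(k : ℕ) * q.1, by
    rw [← nsmul_eq_mul]
    exact nsmul_mem q.2.1 _, mul_pos (by exact_mod_cast k.pos) q.2.2⟩
  one_smul q := Subtype.ext (by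
    change (((1 : ℕ+) : ℕ) : ℚ) * q.1 = q.1
    simp)
  mul_smul k l q := Subtype.ext (by
    change (((k * l : ℕ+) : ℕ) : ℚ) * q.1 = (k : ℕ) * ((l : ℕ) * q.1)
    push_cast
    ring)

theorem coe_positivePart_smul {H : AddSubgroup ℚ} (k : ℕ+) (q : {q : ℚ // q ∈ H ∧ 0 < q}) :
    ((k • q : {q : ℚ // q ∈ H ∧ 0 < q}) : ℚ) = (k : ℕ) * (q : ℚ) := rfl

/-- Bézout after clearing denominators. The divisor is given as an integer combination of x and y so
that it lies in any subgroup containing both. -/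
theorem exists_rat_common_divisor {x y : ℚ} (hx : 0 < x) (hy : 0 < y) :
    ∃ (m n : ℤ) (k l : ℕ+), (k : ℕ) * (m * x + n * y) = x ∧ (l : ℕ) * (m * x + n * y) = y := by
  have hxn : 0 < x.num := Rat.num_pos.2 hx
  have hyn : 0 < y.num := Rat.num_pos.2 hy
  have hxd : (x.den : ℚ) ≠ 0 := by exact_mod_cast x.den_ne_zero
  have hyd : (y.den : ℚ) ≠ 0 := by exact_mod_cast y.den_ne_zero
  set a : ℤ := x.num * y.den with ha
  set b : ℤ := y.num * x.den with hb
  have ha0 : 0 < a := mul_pos hxn (by exact_mod_cast y.den_pos)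
  have hb0 : 0 < b := mul_pos hyn (by exact_mod_cast x.den_pos)
  have hg : 0 < (Int.gcd a b : ℤ) := by
    exact_mod_cast Int.gcd_pos_of_ne_zero_left b ha0.ne'
  obtain ⟨k, hk⟩ := Int.gcd_dvd_left a b
  obtain ⟨l, hl⟩ := Int.gcd_dvd_right a b
  have hk0 : 0 < k := pos_of_mul_pos_right (hk ▸ ha0) hg.le
  have hl0 : 0 < l := pos_of_mul_pos_right (hl ▸ hb0) hg.le
  have hbez := Int.gcd_eq_gcd_ab a b
  lift k to ℕ using hk0.le
  lift l to ℕ using hl0.le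
  have hxa : (a : ℚ) = x * (x.den * y.den) := by
    rw [ha]
    push_cast
    rw [← Rat.den_mul_eq_num x]
    ring
  have hyb : (b : ℚ) = y * (x.den * y.den) := by
    rw [hb]
    push_cast
    rw [← Rat.den_mul_eq_num y]
    ring
  have hz : ((Int.gcd a b : ℤ) : ℚ) =
      ((Int.gcdA a b : ℚ) * x + Int.gcdB a b * y) * (x.den * y.den) := by
    rw [hbez]
    push_cast
    rw [hxa, hyb]
    ring
  have hD : (x.den : ℚ) * y.den ≠ 0 := mul_ne_zero hxd hyd
  refine ⟨Int.gcdA a b, Int.gcdB a b, ⟨k, by exact_mod_cast hk0⟩, ⟨l, by exact_mod_cast hl0⟩,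
    mul_right_cancel₀ hD ?_, mul_right_cancel₀ hD ?_⟩
  · have h1 : (a : ℚ) = ((Int.gcd a b : ℤ) : ℚ) * k := by exact_mod_cast hk
    rw [← hxa, h1, hz, PNat.mk_coe]
    ring
  · have h1 : (b : ℚ) = ((Int.gcd a b : ℤ) : ℚ) * l := by exact_mod_cast hl
    rw [← hyb, h1, hz, PNat.mk_coe]
    ring

theorem isFlatAction_positivePart {H : AddSubgroup ℚ} (hH : ∃ q ∈ H, 0 < q) :
    IsFlatAction {q : ℚ // q ∈ H ∧ 0 < q} where
  nonempty := by
    obtain ⟨q, hq, hq0⟩ := hH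
    exact ⟨⟨q, hq, hq0⟩⟩
  exists_common_divisor := by
    rintro ⟨x, hx, hx0⟩ ⟨y, hy, hy0⟩
    obtain ⟨m, n, k, l, hk, hl⟩ := exists_rat_common_divisor hx0 hy0
    refine ⟨⟨m * x + n * y, ?_, ?_⟩, k, l, Subtype.ext hk, Subtype.ext hl⟩
    · rw [← zsmul_eq_mul, ← zsmul_eq_mul]
      exact add_mem (zsmul_mem hx m) (zsmul_mem hy n)
    · rw [← hk] at hx0
      exact pos_of_mul_pos_right hx0 (Nat.cast_nonneg _)
  injective := by
    rintro ⟨x, hx, hx0⟩ k l h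
    have h1 : ((k : ℕ) : ℚ) * x = (l : ℕ) * x := congrArg Subtype.val h
    have h2 := mul_right_cancel₀ hx0.ne' h1
    exact_mod_cast h2

theorem exists_point_isAttached (α : Adele) : ∃ P, IsAttached P α := by
  have hflat := isFlatAction_positivePart (exists_pos_mem_subgroupOf α.fin)
  obtain ⟨j, hj⟩ := hflat.exists_equiv
  have hj' : ∀ (k : ℕ+) x, (j (flatAct hflat.point k x) : ℚ) = k * (j x : ℚ) := fun k x => by
    rw [hj, coe_positivePart_smul]
  obtain ⟨f, hf⟩ := exists_stalkHom hflat.point (fun x => |α.real| * ((j x : ℚ) : ℝ))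
    (fun k x => by rw [hj']; push_cast; ring)
    fun x => mul_nonneg (abs_nonneg _) (by exact_mod_cast (j x).2.2.le)
  exact ⟨⟨hflat.point, f⟩, j, hj', hf⟩

/-- Multiplication by `c > 0` as a bijection between positive parts of subgroups of `ℚ`. -/
def positivePartEquiv {H K : AddSubgroup ℚ} {c : ℚ} (hc : 0 < c)
    (h : ∀ q, q ∈ K ↔ c * q ∈ H) :
    {q : ℚ // q ∈ H ∧ 0 < q} ≃ {q : ℚ // q ∈ K ∧ 0 < q} where
  toFun q := ⟨c⁻¹ * q, by rw [h, mul_inv_cancel_left₀ hc.ne']; exact q.2.1,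
    mul_pos (inv_pos.2 hc) q.2.2⟩
  invFun q := ⟨c * q, (h _).1 q.2.1, mul_pos hc q.2.2⟩
  left_inv q := Subtype.ext (mul_inv_cancel_left₀ hc.ne' _)
  right_inv q := Subtype.ext (inv_mul_cancel_left₀ hc.ne' _)

/-- Multiplication by q scales |r| by |q| and the embedding j by |q|⁻¹, so |r|j(x) does not change.
-/
theorem IsAttached.of_adele_equiv {P : RMaxPoint structureSheaf} {α β : Adele}
    (h : IsAttached P α) (hαβ : α ≈ β) : IsAttached P β := by
  obtain ⟨u, q, hr, hf⟩ := adele_equiv_iff.1 hαβ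
  obtain ⟨j, hj, hexp⟩ := h
  have hq : 0 < |(q : ℚ)| := abs_pos.2 q.ne_zero
  have hmem : ∀ r, r ∈ subgroupOf β.fin ↔ |(q : ℚ)| * r ∈ subgroupOf α.fin := fun r => by
    rw [← hf, subgroupOf_zHat_unit_mul, mem_subgroupOf_algebraMap_mul]
    rcases abs_choice (q : ℚ) with h | h
    · rw [h]
    · rw [h, neg_mul, neg_mem_iff]
  have hval : ∀ x, ((j.trans (positivePartEquiv hq hmem)) x : ℚ) = |(q : ℚ)|⁻¹ * j x :=
    fun _ => rfl
  refine ⟨j.trans (positivePartEquiv hq hmem), fun k x => ?_, fun x => ?_⟩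
  · rw [hval, hval, hj]
    ring
  · have hq' : |((q : ℚ) : ℝ)| ≠ 0 := abs_ne_zero.2 (by exact_mod_cast q.ne_zero)
    rw [hexp, hval, ← hr, abs_mul]
    push_cast
    congr 1
    field_simp

theorem mem_iff_of_pos_mem_iff {H K : AddSubgroup ℚ} {c : ℚ}
    (h : ∀ q, 0 < q → (q ∈ K ↔ c * q ∈ H)) (q : ℚ) : q ∈ K ↔ c * q ∈ H := by
  rcases lt_trichotomy q 0 with hq | rfl | hq
  · have := h (-q) (neg_pos.2 hq)
    rwa [mul_neg, neg_mem_iff, neg_mem_iff] at this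
  · simp
  · exact h q hq

theorem IsAttached.adele_equiv {P : RMaxPoint structureSheaf} {α β : Adele}
    (hα : IsAttached P α) (hβ : IsAttached P β) : α ≈ β := by
  obtain ⟨i, hi, hi'⟩ := hα
  obtain ⟨j, hj, hj'⟩ := hβ
  obtain ⟨x₀⟩ := flatSet_nonempty P.point
  have hipos : ∀ x, 0 < (i x : ℚ) := fun x => (i x).2.2
  have hjpos : ∀ x, 0 < (j x : ℚ) := fun x => (j x).2.2
  set c : ℚ := i x₀ / j x₀ with hc
  have hc0 : 0 < c := div_pos (hipos x₀) (hjpos x₀)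
  have hij : ∀ x, (i x : ℚ) = c * j x := fun x => by
    have := equivariant_eq_mul P.point (i := fun x => (i x : ℚ)) (j := fun x => (j x : ℚ))
      hi hj x x₀
    rw [hc]
    field_simp [(hjpos x₀).ne']
    exact this
  have hmem : ∀ q, q ∈ subgroupOf β.fin ↔ c * q ∈ subgroupOf α.fin := by
    refine mem_iff_of_pos_mem_iff fun q hq => ⟨fun h => ?_, fun h => ?_⟩
    · obtain ⟨x, hx⟩ := j.surjective ⟨q, h, hq⟩
      have hx' : (j x : ℚ) = q := congrArg Subtype.val hx
      rw [← hx', ← hij]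
      exact (i x).2.1
    · obtain ⟨x, hx⟩ := i.surjective ⟨c * q, h, mul_pos hc0 hq⟩
      have hx' : (i x : ℚ) = c * q := congrArg Subtype.val hx
      rw [hij] at hx'
      rw [← mul_left_cancel₀ hc0.ne' hx']
      exact (j x).2.1
  have hreal : |β.real| = c * |α.real| := by
    have h1 := (hi' x₀).symm.trans (hj' x₀)
    rw [Real.exp_eq_exp, hij] at h1
    have h2 : ((j x₀ : ℚ) : ℝ) ≠ 0 := by exact_mod_cast (hjpos x₀).ne'
    apply mul_right_cancel₀ h2
    rw [← h1]
    push_cast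
    ring
  -- Only absolute values of the real components have been compared; the sign of q absorbs the
  -- difference, as the subgroups are stable under negation.
  have hsign : ∃ q : ℚˣ, |(q : ℚ)| = c ∧ ((q : ℚ) : ℝ) * α.real = β.real := by
    have hcR : |(c : ℝ)| = c := abs_of_pos (by exact_mod_cast hc0)
    rw [← hcR, ← abs_mul] at hreal
    rcases abs_eq_abs.1 hreal with h | h
    · exact ⟨Units.mk0 c hc0.ne', abs_of_pos hc0, h.symm⟩
    · refine ⟨Units.mk0 (-c) (neg_ne_zero.2 hc0.ne'), ?_, ?_⟩
      · rw [Units.val_mk0, abs_neg, abs_of_pos hc0]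
      · rw [h, Units.val_mk0]
        push_cast
        ring
  obtain ⟨q, hq, hqr⟩ := hsign
  obtain ⟨u, hu⟩ := exists_zHat_unit_mul_eq (a := algebraMap ℚ FinAdele q * α.fin)
    (b := β.fin) (by
      ext r
      rw [mem_subgroupOf_algebraMap_mul, hmem, ← hq]
      rcases abs_choice (q : ℚ) with h | h
      · rw [h]
      · rw [h, neg_mul, neg_mem_iff])
  exact adele_equiv_iff.2 ⟨u, q, hqr, hu⟩

theorem exists_point_equiv : ∃ Θ : RMaxPoints structureSheaf ≃ AdeleClassQuotient,
    ∀ (P : RMaxPoint structureSheaf) (α : Adele),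
      Θ (Quotient.mk _ P) = adeleClass α ↔ IsAttached P α := by
  choose A hA using exists_isAttached
  let F : RMaxPoints structureSheaf → AdeleClassQuotient :=
    Quotient.lift (fun P => adeleClass (A P)) fun P Q h =>
      Quotient.sound (((hA P).of_equiv h).adele_equiv (hA Q))
  have hF : ∀ (P : RMaxPoint structureSheaf) (α : Adele),
      F (Quotient.mk _ P) = adeleClass α ↔ IsAttached P α := fun P α =>
    ⟨fun h => (hA P).of_adele_equiv (Quotient.exact h),
      fun h => Quotient.sound ((hA P).adele_equiv h)⟩
  refine ⟨Equiv.ofBijective F ⟨?_, ?_⟩, hF⟩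
  · rintro ⟨P⟩ ⟨Q⟩ h
    exact Quotient.sound (equiv_of_isAttached ((hF P _).1 h) ((hF Q _).1 rfl))
  · rintro ⟨α⟩
    obtain ⟨P, hP⟩ := exists_point_isAttached α
    exact ⟨Quotient.mk _ P, (hF P α).2 hP⟩

/-! ### The Frobenius action, degenerate points and value groups -/

theorem IsAttached.frob {P : RMaxPoint structureSheaf} {α : Adele} (h : IsAttached P α)
    (t : {t : ℝ // 0 < t}) : IsAttached (P.frob t) (posReal t • α) := by
  obtain ⟨j, hj, hexp⟩ := h
  have hr : (posReal t • α).real = t * α.real := by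
    rw [Units.smul_def, smul_eq_mul, Adele.real_mul, Adele.real_posReal]
  have hf : (posReal t • α).fin = α.fin := by
    rw [Units.smul_def, smul_eq_mul, Adele.fin_mul, Adele.fin_posReal, one_mul]
  rw [IsAttached, hf]
  refine ⟨j, hj, fun (x : flatSet P.point) => ?_⟩
  change ((RMax.frob t (P.hom (toStalk P.point x))).val : ℝ) = _
  rw [RMax.coe_val_frob, hexp, ← Real.exp_mul, hr, abs_mul, abs_of_pos t.2]
  exact congrArg Real.exp ((mul_comm _ _).trans (mul_assoc _ _ _).symm)

theorem adeleClass_zHatUnits_mul_smul (u : zHatˣ) (g : Adeleˣ) (α : Adele) :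
    adeleClass ((zHatUnits u * g) • α) = adeleClass (g • α) := by
  refine (Quotient.sound ⟨u, 1, ?_⟩ : adeleClass (g • α) = _).symm
  rw [map_one, mul_one, mul_smul]

theorem exists_ideleClass_rep (c : IdeleClass) : ∃ (u : zHatˣ) (t : {t : ℝ // 0 < t}),
    c = QuotientGroup.mk (zHatUnits u * posReal t) := by
  obtain ⟨g, rfl⟩ := QuotientGroup.mk_surjective c
  have hmul : (g : Adele) * ((g⁻¹ : Adeleˣ) : Adele) = 1 := g.mul_inv
  have hfin : (g : Adele).fin * ((g⁻¹ : Adeleˣ) : Adele).fin = 1 := by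
    rw [← Adele.fin_mul, hmul]
    rfl
  have hreal : (g : Adele).real ≠ 0 := fun h => by
    have h1 : (g : Adele).real * ((g⁻¹ : Adeleˣ) : Adele).real = 1 := by
      rw [← Adele.real_mul, hmul]
      exact map_one realEquiv
    rw [h, zero_mul] at h1
    exact zero_ne_one h1
  obtain ⟨q, u, hq, hu⟩ := exists_algebraMap_mul_eq_zHat_unit
    ⟨(g : Adele).fin, ((g⁻¹ : Adeleˣ) : Adele).fin, hfin, (mul_comm _ _).trans hfin⟩
  -- The rational must make the finite component a unit and the real one positive. The first
  -- condition leaves the sign free, since -1 ∈ Ẑˣ, and the second then fixes it.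
  have key : ∀ (s : ℚˣ) (w : zHatˣ), 0 < (g : Adele).real * ((s : ℚ) : ℝ) →
      algebraMap ℚ FinAdele s * (g : Adele).fin = ((w : zHat) : FinAdele) →
      ∃ (u : zHatˣ) (t : {t : ℝ // 0 < t}),
        (QuotientGroup.mk g : IdeleClass) = QuotientGroup.mk (zHatUnits u * posReal t) := by
    intro s w hs hw
    refine ⟨w, ⟨_, hs⟩, QuotientGroup.eq.2 ⟨s, ?_⟩⟩
    rw [eq_inv_mul_iff_mul_eq]
    apply Units.ext
    apply Adele.ext_components
    · rw [Units.val_mul, Units.val_mul, Adele.real_mul, Adele.real_mul, Adele.real_principal,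
        Adele.real_zHatUnits, Adele.real_posReal, one_mul]
    · rw [Units.val_mul, Units.val_mul, Adele.fin_mul, Adele.fin_mul, Adele.fin_principal,
        Adele.fin_zHatUnits, Adele.fin_posReal, mul_one, ← hw, mul_comm]
  have hqR : (0 : ℝ) < q := by exact_mod_cast hq
  rcases hreal.lt_or_gt with h | h
  · refine key (Units.mk0 (-q) (neg_ne_zero.2 hq.ne')) (-u) ?_ ?_
    · rw [Units.val_mk0]
      push_cast
      nlinarith
    · rw [Units.val_mk0, map_neg, neg_mul]
      exact congrArg Neg.neg hu
  · exact key (Units.mk0 q hq.ne') u (mul_pos h hqR) hu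

/-- The germ of n at x has image exp(|r|j(x)n), and the products j(x)n with n ∈ ℤ fill H_a: n = 1,
0, -1 give its positive, zero and negative elements. -/
theorem IsAttached.logRange_eq {P : RMaxPoint structureSheaf} {α : Adele} (h : IsAttached P α) :
    P.logRange = {y : ℝ | ∃ q ∈ subgroupOf α.fin, y = |α.real| * (q : ℝ)} := by
  obtain ⟨j, hj, hexp⟩ := h
  have hval : ∀ x (n : ℤ),
      ((P.hom (sectionGerm P.point x (ZMax.mk (n : WithBot ℤ)))).val : ℝ) =
        Real.exp (|α.real| * ((j x : ℚ) : ℝ) * n) := fun x n => by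
    rw [hom_sectionGerm_eq_expFun P.point P.hom x (hexp x), expFun_mk]
  have hmem : ∀ x (n : ℤ), |α.real| * ((j x : ℚ) : ℝ) * n ∈ P.logRange := fun x n => by
    refine ⟨sectionGerm P.point x (ZMax.mk (n : WithBot ℤ)), fun h0 => ?_, ?_⟩
    · have h1 := hval x n
      rw [h0, RMax.coe_val_zero] at h1
      exact (Real.exp_pos _).ne h1
    · rw [hval, Real.log_exp]
  ext y
  constructor
  · rintro ⟨s, hs, rfl⟩
    obtain ⟨x, n, rfl⟩ := exists_sectionGerm P.point s
    induction n using ZMax.induction with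
    | zero => exact absurd ((congrArg P.hom (map_zero (sectionGermHom P.point x))).trans
        (map_zero P.hom)) hs
    | coe n =>
      refine ⟨n • (j x : ℚ), zsmul_mem (j x).2.1 n, ?_⟩
      rw [hval, Real.log_exp, zsmul_eq_mul]
      push_cast
      ring
  · rintro ⟨q, hq, rfl⟩
    rcases lt_trichotomy q 0 with hq0 | rfl | hq0
    · obtain ⟨x, hx⟩ := j.surjective ⟨-q, neg_mem hq, neg_pos.2 hq0⟩
      have h1 := hmem x (-1)
      rw [hx] at h1
      simpa using h1
    · obtain ⟨x⟩ := flatSet_nonempty P.point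
      simpa using hmem x 0
    · obtain ⟨x, hx⟩ := j.surjective ⟨q, hq, hq0⟩
      have h1 := hmem x 1
      rw [hx] at h1
      simpa using h1

theorem IsAttached.isDegenerate_iff {P : RMaxPoint structureSheaf} {α : Adele}
    (h : IsAttached P α) : P.IsDegenerate ↔ α.real = 0 := by
  constructor
  · intro hd
    obtain ⟨j, -, hexp⟩ := h
    obtain ⟨x⟩ := flatSet_nonempty P.point
    have hx : ((j x : ℚ) : ℝ) ≠ 0 := by exact_mod_cast (j x).2.2.ne'
    have h1 := hexp x
    rcases hd (toStalk P.point x) with h0 | h0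
    · rw [h0, RMax.coe_val_zero] at h1
      exact absurd h1 (Real.exp_pos _).ne
    · rw [h0, RMax.coe_val_one, eq_comm, Real.exp_eq_one_iff] at h1
      simpa [hx] using h1
  · intro h0 s
    by_cases hs : P.hom s = 0
    · exact Or.inl hs
    · right
      have h1 : Real.log ((P.hom s).val : ℝ) ∈ P.logRange := ⟨s, hs, rfl⟩
      rw [h.logRange_eq, h0] at h1
      obtain ⟨q, -, hq⟩ := h1
      have hpos : 0 < ((P.hom s).val : ℝ) :=
        lt_of_le_of_ne (NNReal.coe_nonneg _) fun h2 => hs (RMax.ext_val h2.symm)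
      apply RMax.ext_val
      rw [RMax.coe_val_one, ← Real.exp_log hpos, hq]
      simp

theorem RMaxPoint.IsDegenerate.frob_eq {P : RMaxPoint structureSheaf} (h : P.IsDegenerate)
    (t : {t : ℝ // 0 < t}) : P.frob t = P := by
  have h1 : (RMax.frob t : RMax →+* RMax).comp P.hom = P.hom := by
    ext s
    rcases h s with h0 | h0
    · change RMax.frob t (P.hom s) = P.hom s
      rw [h0, map_zero]
    · change RMax.frob t (P.hom s) = P.hom s
      rw [h0, map_one]
  unfold RMaxPoint.frob
  rw [h1]

theorem real_eq_zero_of_posReal_smul_equiv {α : Adele}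
    (h : ∀ t : {t : ℝ // 0 < t}, posReal t • α ≈ α) : α.real = 0 := by
  -- A single irrational λ suffices: invariance under it gives qλr = r with q a nonzero rational,
  -- hence r = 0.
  obtain ⟨u, q, hr, -⟩ := adele_equiv_iff.1 (h ⟨√2, by positivity⟩)
  rw [Units.smul_def, smul_eq_mul, Adele.real_mul, Adele.real_posReal, ← mul_assoc] at hr
  by_contra h0
  have h1 : ((q : ℚ) : ℝ) * √2 = 1 := mul_right_cancel₀ h0 (by rw [hr, one_mul])
  exact ((irrational_sqrt_two.ratCast_mul q.ne_zero).ne_one) h1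

end ArithSite

end

/-! ### The main theorem -/

open ArithSite in
theorem theorem3p5 :
    ∃ Θ : RMaxPoints structureSheaf ≃ AdeleClassQuotient,
      -- the bijection is the canonical one
      (∀ (P : RMaxPoint structureSheaf) (α : Adele),
        Θ (Quotient.mk _ P) = adeleClass α ↔ IsAttached P α) ∧
      -- the Frobenius `Fr_t` corresponds to the idele class of `(t, 1)`
      (∀ (t : {t : ℝ // 0 < t}) (x : RMaxPoints structureSheaf),
        Θ (x.frob t) = (QuotientGroup.mk (posReal t) : IdeleClass) • Θ x) ∧
      -- every idele class comes from `Ẑˣ × ℝ₊ˣ` and acts as a Frobenius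
      (∀ c : IdeleClass, ∃ (u : zHatˣ) (t : {t : ℝ // 0 < t}),
        c = QuotientGroup.mk (zHatUnits u * posReal t) ∧
        ∀ x : RMaxPoints structureSheaf, c • Θ x = Θ (x.frob t)) ∧
      -- degenerate points: the finite adelic part, and the fixed points of the Frobenius
      (∀ P : RMaxPoint structureSheaf,
        (P.IsDegenerate ↔ ∃ a : FinAdele, Θ (Quotient.mk _ P) = adeleClass (Adele.mk 0 a)) ∧
        (P.IsDegenerate ↔ ∀ t : {t : ℝ // 0 < t},
          RMaxPoints.frob t (Quotient.mk _ P) = Quotient.mk _ P)) ∧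
      -- the subgroup of `ℝ` determined by a point
      (∀ (P : RMaxPoint structureSheaf) (α : Adele), Θ (Quotient.mk _ P) = adeleClass α →
        P.logRange = {y : ℝ | ∃ q ∈ subgroupOf α.fin, y = |α.real| * (q : ℝ)}) := by
  obtain ⟨Θ, hΘ⟩ := exists_point_equiv
  have hfrob : ∀ (t : {t : ℝ // 0 < t}) (P : RMaxPoint structureSheaf) (α : Adele),
      IsAttached P α →
        Θ (RMaxPoints.frob t (Quotient.mk _ P)) = adeleClass (posReal t • α) := fun t P α h =>
    (hΘ (P.frob t) _).2 (h.frob t)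
  refine ⟨Θ, hΘ, ?_, ?_, ?_, fun P α h => ((hΘ P α).1 h).logRange_eq⟩
  · rintro t ⟨P⟩
    obtain ⟨α, hα⟩ := exists_isAttached P
    refine (hfrob t P α hα).trans ?_
    exact congrArg ((QuotientGroup.mk (posReal t) : IdeleClass) • ·) ((hΘ P α).2 hα).symm
  · intro c
    obtain ⟨u, t, rfl⟩ := exists_ideleClass_rep c
    refine ⟨u, t, rfl, ?_⟩
    rintro ⟨P⟩
    obtain ⟨α, hα⟩ := exists_isAttached P
    refine Eq.trans ?_ (hfrob t P α hα).symm
    -- The factor in Ẑˣ acts trivially on the quotient, which leaves the Frobenius alone.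
    refine Eq.trans ?_ (adeleClass_zHatUnits_mul_smul u (posReal t) α)
    exact congrArg ((QuotientGroup.mk (zHatUnits u * posReal t) : IdeleClass) • ·)
      ((hΘ P α).2 hα)
  · intro P
    obtain ⟨α, hα⟩ := exists_isAttached P
    refine ⟨⟨fun h => ⟨α.fin, (hΘ P _).2 ?_⟩, ?_⟩, fun h t => ?_, fun h => ?_⟩
    · have h0 := hα.isDegenerate_iff.1 h
      have h1 : Adele.mk 0 α.fin = α :=
        Adele.ext_components ((Adele.real_mk 0 _).trans h0.symm) (Adele.fin_mk 0 _)
      rwa [h1]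
    · rintro ⟨a, ha⟩
      exact ((hΘ P _).1 ha).isDegenerate_iff.2 (Adele.real_mk 0 a)
    · exact congrArg (Quotient.mk _) (h.frob_eq t)
    · refine hα.isDegenerate_iff.2 (real_eq_zero_of_posReal_smul_equiv fun t => ?_)
      have h1 := hfrob t P α hα
      rw [h t, (hΘ P α).2 hα] at h1
      exact Quotient.exact h1.symm
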